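/- Let $R$ be a supercommutative $\mathbb{Z}/2$-graded algebra over $\mathbb{Q}$ ("superfields") with an odd derivation $D_\theta$ (e.g. $D_\theta=\partial_\theta+\theta\partial_x$ on functions of $x,\theta$ and further even and odd times), and put $\partial_x=D_\theta^2$. Super-pseudo-differential operators are formal series $\sum_{j\le N}a_j\mathcal D^j$, $a_j\in R$, multiplied by the rule $\mathcal D a=D_\theta(a)+(-1)^{|a|}a\,\mathcal D$; $A_+$ and $A_-$ denote the parts with $j\ge 0$ and $j<0$, and $\{A,B\}=AB+BA$. For a purely differential operator $A$, $A(F)$ denotes its action on a superfield $F$. Let $f_0\in R$ be odd, let $\Phi_0,\Psi_0\in R$ be even with $\Phi_0$ invertible, and let $$\mathcal L=\mathcal D+f_0+\Phi_0\mathcal D^{-1}\Psi_0 .$$ As $D_\theta^{-1}$ is defined only up to constants of integration, fix superfields $\phi_k=\mathcal L^k(\Phi_0)$, $\psi_k=(\mathcal L^k)^*(\Psi_0)$ and potentials $S_{ij}=D_\theta^{-1}(\psi_i\phi_j)$ of parity $i+j+1$; that is, $\phi_0=\Phi_0$, $\psi_0=\Psi_0$, $D_\theta S_{ij}=\psi_i\phi_j$,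 $$\phi_{k+1}=D_\theta\phi_k+f_0\phi_k+\Phi_0S_{0k},\qquad \psi_{k+1}=(-1)^k\bigl(-D_\theta\psi_k+f_0\psi_k+\Psi_0S_{k0}\bigr),$$ the constants being consistent with $D_\theta^{-1}D_\theta=1$: $S_{i,j+1}-S_{i+1,j}=(-1)^i\psi_i\phi_j+S_{i0}S_{0j}$ (both sides automatically have the same image under $D_\theta$). Put $$X^{(2n-1)}=2\sum_{l=0}^{n-2}\phi_{2(n-l)-3}\,\mathcal D^{-1}\psi_{2l+1},\qquad X^{(2n-1)}(\Phi_0)=2\sum_{l=0}^{n-2}\phi_{2(n-l)-3}\,S_{2l+1,0}.$$ Let $\mathcal T=\Phi_0\mathcal D\Phi_0^{-1}$ and $\widetilde{\mathcal L}=\mathcal T\mathcal L\mathcal T^{-1}$. Then: (1) $\widetilde{\mathcal L}=\mathcal D+\widetilde f_0+\widetilde\Phi_0\mathcal D^{-1}\widetilde\Psi_0$ with $$\widetilde f_0=-f_0-2D_\theta\ln\Phi_0,\quad \widetilde\Phi_0=\mathcal T\bigl(\mathcal L(\Phi_0)\bigr)=\Phi_0\,\partial_x\ln\Phi_0+\Phi_0D_\theta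 f_0+\Phi_0^2\Psi_0,\quad \widetilde\Psi_0=\Phi_0^{-1},$$ where $D_\theta\ln\Phi_0=\Phi_0^{-1}D_\theta\Phi_0$ and $\partial_x\ln\Phi_0=\Phi_0^{-1}\partial_x\Phi_0$; here $\widetilde f_0$ is odd, $\widetilde\Phi_0,\widetilde\Psi_0$ are even, and $D_\theta\widetilde f_0+2\widetilde\Phi_0\widetilde\Psi_0=D_\theta f_0+2\Phi_0\Psi_0$. (So the condition $D_\theta f_0+2\Phi_0\Psi_0=0$, i.e. the absence of a zero-order term in $\mathcal L^2$, is preserved.) (2) There are superfields and potentials for $\widetilde{\mathcal L}$ with the same properties as those for $\mathcal L$ above and with $$\widetilde{\mathcal L}^{s}(\widetilde\Phi_0)=\mathcal T\bigl(\mathcal L^{s+1}(\Phi_0)\bigr),\qquad (\widetilde{\mathcal L}^{s+1})^*(\widetilde\Psi_0)=(-1)^s\Phi_0^{-1}D_\theta^{-1}\bigl(\Phi_0(\mathcal L^s)^*(\Psi_0)\bigr)\qquad(s\ge 0),$$ where the last potential is $S_{s0}$. They determine $\widetilde X^{(2n-1)}$ by the tilded version of the formula for $X^{(2n-1)}$,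 and they satisfy (3). (3) Let $n\ge1$ and let $D_n$ be an odd derivation of $R$ that anticommutes with $D_\theta$ and obeys the modified fermionic flow equation $$D_n\Phi_0=(\mathcal L^{2n-1})_+(\Phi_0)-2\mathcal L^{2n-1}(\Phi_0)+X^{(2n-1)}(\Phi_0).$$ Then, with $D_n$ acting on operators through their coefficients, $$D_n\mathcal T\,\mathcal T^{-1}-\bigl(\mathcal T(\mathcal L^{2n-1})_+\mathcal T^{-1}\bigr)_-=-2(\widetilde{\mathcal L}^{2n-1})_-+\widetilde X^{(2n-1)}+\mathcal TX^{(2n-1)}\mathcal T^{-1}.$$ Consequently the modified fermionic Lax flow is preserved: if also $D_n\mathcal L=-\{(\mathcal L^{2n-1})_--X^{(2n-1)},\mathcal L\}$, then $D_n\widetilde{\mathcal L}=-\{(\widetilde{\mathcal L}^{2n-1})_--\widetilde X^{(2n-1)},\widetilde{\mathcal L}\}$. -/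

import Mathlib

/-- A differential superalgebra ("superfields" on superspace): a supercommutative superalgebra `R`
over the rationals together with an odd derivation `Dθ`.  As `2` is invertible, the
`ℤ/2`-grading is the same thing as its parity involution `par` (the algebra automorphism equal to
`+1` on bosonic (even) elements and to `-1` on fermionic (odd) elements).  The superfield functions
of `(x, θ; t₂, t₃, …; θ₁, θ₂, …)` with `Dθ = ∂/∂θ + θ ∂/∂x` are the main example. -/
class DiffSuperalgebra (R : Type*) [Ring R] [Algebra ℚ R] where
  /-- the parity involution `a ↦ (-1)^|a| a` -/
  par : R →+* R
  par_par : ∀ a, par (par a) = a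
  /-- bosonic elements commute with everything -/
  even_comm : ∀ a b, par a = a → a * b = b * a
  /-- fermionic elements anticommute with each other -/
  odd_anticomm : ∀ a b, par a = -a → par b = -b → a * b = -(b * a)
  /-- the odd derivation -/
  Dθ : R →+ R
  Dθ_mul : ∀ a b, Dθ (a * b) = Dθ a * b + par a * Dθ b
  par_Dθ : ∀ a, par (Dθ a) = -Dθ (par a)

namespace SuperKP

open DiffSuperalgebra

/-- Super-pseudo-differential operators `∑_{n ≤ N} a_n 𝒟^n`, stored as the sequence `n ↦ a_n` of
their left coefficients, which vanishes for large `n`. -/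
def SPDO (R : Type*) [Ring R] : Type _ :=
  { carrier := {f : ℤ → R | ∃ N : ℤ, ∀ n, N < n → f n = 0}
    zero_mem' := ⟨0, fun _ _ => rfl⟩
    add_mem' := by
      rintro f g ⟨N, hN⟩ ⟨M, hM⟩
      refine ⟨max N M, fun n hn => ?_⟩
      simp [hN n (lt_of_le_of_lt (le_max_left _ _) hn),
        hM n (lt_of_le_of_lt (le_max_right _ _) hn)]
    neg_mem' := by
      rintro f ⟨N, hN⟩
      exact ⟨N, fun n hn => by simp [hN n hn]⟩ : AddSubgroup (ℤ → R) }

namespace SPDO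

variable {R : Type*} [Ring R]

instance : AddCommGroup (SPDO R) := by unfold SPDO; infer_instance

/-- The coefficient of `𝒟^n`. -/
def coeff (A : SPDO R) (n : ℤ) : R := A.1 n

@[ext] theorem ext {A B : SPDO R} (h : ∀ n, A.coeff n = B.coeff n) : A = B :=
  Subtype.ext (funext h)

/-- The operator with given coefficients. -/
def mk (f : ℤ → R) (h : ∃ N : ℤ, ∀ n, N < n → f n = 0) : SPDO R := ⟨f, h⟩

@[simp] theorem coeff_mk (f : ℤ → R) (h) (n : ℤ) : (mk f h).coeff n = f n := rfl

@[simp] theorem coeff_add (A B : SPDO R) (n : ℤ) :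
    (A + B).coeff n = A.coeff n + B.coeff n := rfl

@[simp] theorem coeff_zero (n : ℤ) : (0 : SPDO R).coeff n = 0 := rfl

/-- `A` has order at most `N`. -/
def OrderLE (A : SPDO R) (N : ℤ) : Prop := ∀ n, N < n → A.coeff n = 0

theorem exists_orderLE (A : SPDO R) : ∃ N, A.OrderLE N := A.2

/-- The monomial `a 𝒟^k`. -/
def single (k : ℤ) (a : R) : SPDO R :=
  mk (fun n => if n = k then a else 0) ⟨k, fun n hn => by simp [hn.ne']⟩

@[simp] theorem coeff_single (k : ℤ) (a : R) (n : ℤ) :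
    (single k a).coeff n = if n = k then a else 0 := rfl

/-- Apply an additive map to every coefficient. -/
def mapCoeff (δ : R →+ R) (A : SPDO R) : SPDO R :=
  mk (fun n => δ (A.coeff n)) (by
    obtain ⟨N, hN⟩ := A.exists_orderLE
    exact ⟨N, fun n hn => by simp [hN n hn]⟩)

/-- The purely differential part `A₊`. -/
def plus (A : SPDO R) : SPDO R :=
  mk (fun n => if 0 ≤ n then A.coeff n else 0) (by
    obtain ⟨N, hN⟩ := A.exists_orderLE
    exact ⟨N, fun n hn => by simp [hN n hn]⟩)

/-- The purely pseudo-differential part `A₋`. -/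
def minus (A : SPDO R) : SPDO R :=
  mk (fun n => if n < 0 then A.coeff n else 0) (by
    obtain ⟨N, hN⟩ := A.exists_orderLE
    exact ⟨N, fun n hn => by simp [hN n hn]⟩)

theorem OrderLE.mono {A : SPDO R} {N M : ℤ} (h : A.OrderLE N) (hNM : N ≤ M) : A.OrderLE M :=
  fun n hn => h n (by omega)

theorem OrderLE.add {A B : SPDO R} {N : ℤ} (hA : A.OrderLE N) (hB : B.OrderLE N) :
    (A + B).OrderLE N := fun n hn => by simp [hA n hn, hB n hn]

variable [Algebra ℚ R] [DiffSuperalgebra R]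

/-- Left multiplication by `𝒟`, by the rule `𝒟 a = Dθ(a) + (-1)^|a| a 𝒟`. -/
def dMulHom : SPDO R →+ SPDO R where
  toFun A := mk (fun n => Dθ (A.coeff n) + par (A.coeff (n - 1))) (by
    obtain ⟨N, hN⟩ := A.exists_orderLE
    refine ⟨N + 1, fun n hn => ?_⟩
    simp [hN n (by omega), hN (n - 1) (by omega)])
  map_zero' := by ext n; simp
  map_add' A B := by ext n; simp; abel

@[simp] theorem coeff_dMulHom (A : SPDO R) (n : ℤ) :
    (dMulHom A).coeff n = Dθ (A.coeff n) + par (A.coeff (n - 1)) := rfl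

theorem par_injective : Function.Injective (par : R → R) :=
  Function.LeftInverse.injective (g := par) par_par

theorem orderLE_of_dMulHom {A : SPDO R} {N : ℤ} (h : (dMulHom A).OrderLE N) :
    A.OrderLE (N - 1) := by
  obtain ⟨M, hM⟩ := A.exists_orderLE
  have key : ∀ (k : ℕ) (n : ℤ), N - 1 < n → M - k < n → A.coeff n = 0 := by
    intro k
    induction k with
    | zero => intro n _ h2; exact hM n (by simpa using h2)
    | succ k ih =>
      intro n h1 h2
      have h3 := h (n + 1) (by omega)
      rw [coeff_dMulHom, ih (n + 1) (by omega) (by push_cast at h2; omega), map_zero, zero_add,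
        add_sub_cancel_right] at h3
      exact par_injective (by rw [h3, map_zero])
  intro n hn
  exact key (M - n + 1).toNat n hn (by omega)

theorem dMulHom_injective : Function.Injective (dMulHom : SPDO R → SPDO R) := by
  rw [injective_iff_map_eq_zero]
  intro A hA
  ext n
  refine orderLE_of_dMulHom (N := n) ?_ n (by omega)
  intro m _
  rw [hA]; rfl

/-- The coefficients of `𝒟⁻¹ A` from the top downwards, for `A` of order at most `N`: the
`k`-th entry is the coefficient of `𝒟^(N - k)`. -/
def invCoeff (A : SPDO R) (N : ℤ) : ℕ → R
  | 0 => 0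
  | k + 1 => par (A.coeff (N - k) - Dθ (invCoeff A N k))

theorem dMulHom_surjective : Function.Surjective (dMulHom : SPDO R → SPDO R) := by
  intro A
  obtain ⟨N, hN⟩ := A.exists_orderLE
  have hz : ∀ n, N ≤ n → (fun n : ℤ => invCoeff A N (N - n).toNat) n = 0 := by
    intro n hn
    have : (N - n).toNat = 0 := by omega
    simp [this, invCoeff]
  refine ⟨mk (fun n => invCoeff A N (N - n).toNat) ⟨N, fun n hn => hz n hn.le⟩, ?_⟩
  ext n
  rw [coeff_dMulHom, coeff_mk, coeff_mk]
  by_cases hn : N < n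
  · have h1 := hz n hn.le
    have h2 := hz (n - 1) (by omega)
    simp only at h1 h2
    simp [h1, h2, hN n hn]
  · obtain ⟨k, hk⟩ : ∃ k : ℕ, n = N - k := ⟨(N - n).toNat, by omega⟩
    have h1 : (N - n).toNat = k := by omega
    have h2 : (N - (n - 1)).toNat = k + 1 := by omega
    rw [h1, h2, invCoeff, par_par, hk]
    abel

/-- Left multiplication by `𝒟` as an invertible additive map. -/
noncomputable def dMulUnit : (AddMonoid.End (SPDO R))ˣ where
  val := dMulHom
  inv := (AddEquiv.ofBijective dMulHom ⟨dMulHom_injective, dMulHom_surjective⟩).symm.toAddMonoidHom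
  val_inv := by
    ext1 A
    exact (AddEquiv.ofBijective dMulHom
      ⟨dMulHom_injective, dMulHom_surjective⟩ : SPDO R ≃+ SPDO R).apply_symm_apply A
  inv_val := by
    ext1 A
    exact (AddEquiv.ofBijective dMulHom
      ⟨dMulHom_injective, dMulHom_surjective⟩ : SPDO R ≃+ SPDO R).symm_apply_apply A

/-- Left multiplication by `𝒟^k`, `k ∈ ℤ`. -/
noncomputable def dPow (k : ℤ) : SPDO R →+ SPDO R :=
  ((dMulUnit ^ k : (AddMonoid.End (SPDO R))ˣ) : AddMonoid.End (SPDO R))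

@[simp] theorem dPow_zero (A : SPDO R) : dPow 0 A = A := rfl

theorem dPow_one (A : SPDO R) : dPow 1 A = dMulHom A := by
  unfold dPow
  rw [zpow_one]; rfl

theorem dPow_succ (k : ℤ) (A : SPDO R) : dPow (k + 1) A = dMulHom (dPow k A) := by
  unfold dPow
  rw [add_comm, zpow_add, zpow_one]; rfl

theorem zpow_ind {p : ℤ → Prop} (h0 : p 0) (h : ∀ k, p k ↔ p (k + 1)) (k : ℤ) : p k := by
  induction k using Int.induction_on with
  | zero => exact h0
  | succ n ih => exact (h _).1 ih
  | pred n ih => exact (h _).2 (by simpa using ih)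

theorem orderLE_dPow {A : SPDO R} {N : ℤ} (hA : A.OrderLE N) (k : ℤ) :
    (dPow k A).OrderLE (N + k) := by
  refine zpow_ind (p := fun k => (dPow k A).OrderLE (N + k)) (by simpa using hA) ?_ k
  intro k
  rw [dPow_succ]
  constructor
  · intro h n hn
    rw [coeff_dMulHom, h n (by omega), h (n - 1) (by omega)]
    simp
  · intro h
    have := orderLE_of_dMulHom h
    rwa [show N + (k + 1) - 1 = N + k by ring] at this

/-- The product of super-pseudo-differential operators,
`(∑ a_k 𝒟^k) B = ∑ a_k (𝒟^k B)`; every coefficient of the right side is a finite sum. -/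
noncomputable instance : Mul (SPDO R) where
  mul A B := mk (fun n => ∑ᶠ k : ℤ, A.coeff k * (dPow k B).coeff n) (by
    obtain ⟨N, hN⟩ := A.exists_orderLE
    obtain ⟨M, hM⟩ := B.exists_orderLE
    refine ⟨N + M, fun n hn => finsum_eq_zero_of_forall_eq_zero fun k => ?_⟩
    by_cases hk : N < k
    · rw [hN k hk, zero_mul]
    · rw [orderLE_dPow hM k n (by omega), mul_zero])

theorem coeff_mul (A B : SPDO R) (n : ℤ) :
    (A * B).coeff n = ∑ᶠ k : ℤ, A.coeff k * (dPow k B).coeff n := rfl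

theorem coeff_mul_eq_sum {A B : SPDO R} {N M : ℤ} (hA : A.OrderLE N) (hB : B.OrderLE M)
    {n lo hi : ℤ} (hlo : lo ≤ n - M) (hhi : N ≤ hi) :
    (A * B).coeff n = ∑ k ∈ Finset.Icc lo hi, A.coeff k * (dPow k B).coeff n := by
  rw [coeff_mul]
  refine finsum_eq_sum_of_support_subset _ fun k hk => ?_
  rw [Function.mem_support] at hk
  rw [Finset.coe_Icc, Set.mem_Icc]
  constructor
  · by_contra h
    exact hk (by rw [orderLE_dPow hB k n (by omega), mul_zero])
  · by_contra h
    exact hk (by rw [hA k (by omega), zero_mul])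

theorem OrderLE.mul {A B : SPDO R} {N M : ℤ} (hA : A.OrderLE N) (hB : B.OrderLE M) :
    (A * B).OrderLE (N + M) := by
  intro n hn
  rw [coeff_mul_eq_sum hA hB (lo := n - M) (hi := N) le_rfl le_rfl, Finset.Icc_eq_empty (by omega),
    Finset.sum_empty]

protected theorem add_mul (A B C : SPDO R) : (A + B) * C = A * C + B * C := by
  obtain ⟨N, hN⟩ := A.exists_orderLE
  obtain ⟨M, hM⟩ := B.exists_orderLE
  obtain ⟨L, hL⟩ := C.exists_orderLE
  have hN' := hN.mono (le_max_left N M)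
  have hM' := hM.mono (le_max_right N M)
  ext n
  rw [coeff_add, coeff_mul_eq_sum (hN'.add hM') hL le_rfl le_rfl,
    coeff_mul_eq_sum hN' hL le_rfl le_rfl, coeff_mul_eq_sum hM' hL le_rfl le_rfl,
    ← Finset.sum_add_distrib]
  exact Finset.sum_congr rfl fun k _ => by rw [coeff_add, add_mul]

protected theorem mul_add (A B C : SPDO R) : A * (B + C) = A * B + A * C := by
  obtain ⟨N, hN⟩ := A.exists_orderLE
  obtain ⟨M, hM⟩ := B.exists_orderLE
  obtain ⟨L, hL⟩ := C.exists_orderLE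
  have hM' := hM.mono (le_max_left M L)
  have hL' := hL.mono (le_max_right M L)
  ext n
  rw [coeff_add, coeff_mul_eq_sum hN (hM'.add hL') le_rfl le_rfl,
    coeff_mul_eq_sum hN hM' le_rfl le_rfl, coeff_mul_eq_sum hN hL' le_rfl le_rfl,
    ← Finset.sum_add_distrib]
  exact Finset.sum_congr rfl fun k _ => by rw [map_add, coeff_add, mul_add]

theorem dMulHom_mul (B C : SPDO R) : dMulHom (B * C) = dMulHom B * C := by
  obtain ⟨M, hM⟩ := B.exists_orderLE
  obtain ⟨L, hL⟩ := C.exists_orderLE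
  have hB' : (dMulHom B).OrderLE (M + 1) := by
    rw [← dPow_one]; exact orderLE_dPow hM 1
  ext n
  rw [coeff_dMulHom,
    coeff_mul_eq_sum hM hL (lo := n - 1 - L) (hi := M + 1) (by omega) (by omega),
    coeff_mul_eq_sum hM hL (lo := n - 1 - L) (hi := M) (by omega) (by omega),
    coeff_mul_eq_sum hB' hL (lo := n - 1 - L) (hi := M + 1) (by omega) (by omega),
    map_sum, map_sum]
  have h1 : ∀ k, (dMulHom B).coeff k * (dPow k C).coeff n
      = Dθ (B.coeff k) * (dPow k C).coeff n
        + par (B.coeff (k - 1)) * (dPow k C).coeff n := by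
    intro k; rw [coeff_dMulHom, add_mul]
  have h2 : ∀ k, (dPow (k + 1) C).coeff n
      = Dθ ((dPow k C).coeff n) + par ((dPow k C).coeff (n - 1)) := by
    intro k; rw [dPow_succ, coeff_dMulHom]
  have h3 : ∑ k ∈ Finset.Icc (n - 1 - L) (M + 1),
        par (B.coeff (k - 1)) * (dPow k C).coeff n
      = ∑ k ∈ Finset.Icc (n - 1 - L) (M + 1), par (B.coeff k) * (dPow (k + 1) C).coeff n := by
    have e1 : ∑ k ∈ Finset.Icc (n - L) (M + 1), par (B.coeff (k - 1)) * (dPow k C).coeff n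
        = ∑ k ∈ Finset.Icc (n - 1 - L) (M + 1),
          par (B.coeff (k - 1)) * (dPow k C).coeff n := by
      refine Finset.sum_subset (fun k hk => ?_) fun k hk hk' => ?_
      · simp only [Finset.mem_Icc] at hk ⊢; omega
      · simp only [Finset.mem_Icc] at hk hk'
        rw [orderLE_dPow hL k n (by omega)]; simp
    have e2 : ∑ k ∈ Finset.Icc (n - 1 - L) M, par (B.coeff k) * (dPow (k + 1) C).coeff n
        = ∑ k ∈ Finset.Icc (n - 1 - L) (M + 1),
          par (B.coeff k) * (dPow (k + 1) C).coeff n := by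
      refine Finset.sum_subset (fun k hk => ?_) fun k hk hk' => ?_
      · simp only [Finset.mem_Icc] at hk ⊢; omega
      · simp only [Finset.mem_Icc] at hk hk'
        rw [hM k (by omega)]; simp
    rw [← e1, ← e2]
    refine Finset.sum_bij' (fun k _ => k - 1) (fun k _ => k + 1) ?_ ?_ ?_ ?_ ?_
    · intro k hk; simp only [Finset.mem_Icc] at hk ⊢; omega
    · intro k hk; simp only [Finset.mem_Icc] at hk ⊢; omega
    · intro k _; ring
    · intro k _; ring
    · intro k _; rw [sub_add_cancel]
  have h4 : ∑ k ∈ Finset.Icc (n - 1 - L) M, par (B.coeff k * (dPow k C).coeff (n - 1))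
      = ∑ k ∈ Finset.Icc (n - 1 - L) (M + 1), par (B.coeff k * (dPow k C).coeff (n - 1)) := by
    refine Finset.sum_subset (fun k hk => ?_) fun k hk hk' => ?_
    · simp only [Finset.mem_Icc] at hk ⊢; omega
    · simp only [Finset.mem_Icc] at hk hk'
      rw [hM k (by omega)]; simp
  rw [Finset.sum_congr rfl fun k _ => h1 k, Finset.sum_add_distrib, h3, h4,
    ← Finset.sum_add_distrib, ← Finset.sum_add_distrib]
  refine Finset.sum_congr rfl fun k _ => ?_
  rw [h2, Dθ_mul, map_mul, mul_add]
  abel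

theorem dPow_mul (k : ℤ) (B C : SPDO R) : dPow k (B * C) = dPow k B * C := by
  refine zpow_ind (p := fun k => dPow k (B * C) = dPow k B * C) (by simp) ?_ k
  intro k
  rw [dPow_succ, dPow_succ, ← dMulHom_mul]
  exact dMulHom_injective.eq_iff.symm

protected theorem mul_assoc (A B C : SPDO R) : A * B * C = A * (B * C) := by
  obtain ⟨N, hN⟩ := A.exists_orderLE
  obtain ⟨M, hM⟩ := B.exists_orderLE
  obtain ⟨L, hL⟩ := C.exists_orderLE
  ext n
  rw [coeff_mul_eq_sum (hN.mul hM) hL (lo := n - L) le_rfl le_rfl,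
    coeff_mul_eq_sum hN (hM.mul hL) (lo := n - L - M) (hi := N) (by omega) le_rfl]
  have h1 : ∀ j ∈ Finset.Icc (n - L) (N + M), (A * B).coeff j * (dPow j C).coeff n
      = ∑ k ∈ Finset.Icc (n - L - M) N,
          A.coeff k * (dPow k B).coeff j * (dPow j C).coeff n := by
    intro j hj
    rw [Finset.mem_Icc] at hj
    rw [coeff_mul_eq_sum hN hM (lo := n - L - M) (hi := N) (by omega) le_rfl, Finset.sum_mul]
  have h2 : ∀ k ∈ Finset.Icc (n - L - M) N, A.coeff k * (dPow k (B * C)).coeff n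
      = ∑ j ∈ Finset.Icc (n - L) (N + M),
          A.coeff k * (dPow k B).coeff j * (dPow j C).coeff n := by
    intro k hk
    rw [Finset.mem_Icc] at hk
    rw [dPow_mul, coeff_mul_eq_sum (orderLE_dPow hM k) hL (lo := n - L) (hi := N + M)
      le_rfl (by omega), Finset.mul_sum]
    exact Finset.sum_congr rfl fun j _ => by rw [mul_assoc]
  rw [Finset.sum_congr rfl h1, Finset.sum_congr rfl h2, Finset.sum_comm]

theorem Dθ_one : Dθ (1 : R) = 0 := by
  have h := Dθ_mul (1 : R) 1
  rw [map_one par, one_mul, mul_one] at h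
  simpa using h

theorem dPow_single (k j : ℤ) : dPow k (single j (1 : R)) = single (j + k) 1 := by
  have hs : ∀ j : ℤ, dMulHom (single j (1 : R)) = single (j + 1) 1 := by
    intro j
    ext n
    rw [coeff_dMulHom, coeff_single, coeff_single, coeff_single]
    split_ifs <;> first | omega | simp [Dθ_one]
  refine zpow_ind (p := fun k => dPow k (single j (1 : R)) = single (j + k) 1)
    (by simp) ?_ k
  intro k
  rw [dPow_succ, ← add_assoc, ← hs]
  exact dMulHom_injective.eq_iff.symm

theorem coeff_single_mul (k : ℤ) (a : R) (B : SPDO R) (n : ℤ) :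
    (single k a * B).coeff n = a * (dPow k B).coeff n := by
  rw [coeff_mul, finsum_eq_single _ k]
  · simp
  · intro j hj; simp [hj]

noncomputable instance : Ring (SPDO R) :=
  { (inferInstance : AddCommGroup (SPDO R)), (inferInstance : Mul (SPDO R)) with
    one := single 0 1
    mul_assoc := SPDO.mul_assoc
    left_distrib := SPDO.mul_add
    right_distrib := SPDO.add_mul
    one_mul := fun A => by
      ext n
      exact (coeff_single_mul 0 1 A n).trans (by simp)
    mul_one := fun A => by
      ext n
      change (A * single 0 1).coeff n = _
      rw [coeff_mul, finsum_eq_single _ n]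
      · rw [dPow_single]; simp
      · intro j hj
        rw [dPow_single]; simp [hj.symm]
    zero_mul := fun A => by
      ext n
      rw [coeff_mul]
      simp
    mul_zero := fun A => by
      ext n
      rw [coeff_mul]
      simp
    zsmul := fun n A => n • A
    nsmul := fun n A => n • A }

theorem one_def : (1 : SPDO R) = single 0 1 := rfl

/-- The operator of multiplication by a superfield. -/
noncomputable def C : R →+* SPDO R where
  toFun a := single 0 a
  map_one' := rfl
  map_mul' a b := by
    ext n
    rw [coeff_single_mul]
    simp
  map_zero' := by ext n; simp
  map_add' a b := by
    ext n
    simp only [coeff_single, coeff_add]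
    split_ifs <;> simp

theorem single_mul_single (j k : ℤ) :
    (single j 1 * single k 1 : SPDO R) = single (k + j) 1 := by
  ext n
  rw [coeff_single_mul, dPow_single, one_mul]

/-- The invertible operator `𝒟`. -/
noncomputable def 𝒟 : (SPDO R)ˣ where
  val := single 1 1
  inv := single (-1) 1
  val_inv := by rw [single_mul_single]; rfl
  inv_val := by rw [single_mul_single]; rfl

/-- The defining commutation rule `𝒟 a = Dθ(a) + (-1)^|a| a 𝒟`. -/
theorem 𝒟_mul_C (a : R) :
    ((𝒟 : (SPDO R)ˣ) : SPDO R) * C a = C (Dθ a) + C (par a) * ((𝒟 : (SPDO R)ˣ) : SPDO R) := by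
  ext n
  change (single 1 1 * single 0 a : SPDO R).coeff n
    = (single 0 (Dθ a) + single 0 (par a) * single 1 1 : SPDO R).coeff n
  rw [coeff_add, coeff_single_mul, coeff_single_mul, dPow_single, dPow_one, coeff_dMulHom]
  simp only [coeff_single]
  split_ifs <;> first | omega | simp

/-- The application `A₊(F)` of the differential part of an operator to a superfield;
it is `A(F)` when `A` is purely differential. -/
noncomputable def apply (A : SPDO R) (F : R) : R := ∑ᶠ j : ℕ, A.coeff j * Dθ^[j] F

end SPDO

open SPDO

variable {R : Type*} [Ring R] [Algebra ℚ R] [DiffSuperalgebra R]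

/-- Bosonic superfields. -/
def IsEven (a : R) : Prop := par a = a

/-- Fermionic superfields. -/
def IsOdd (a : R) : Prop := par a = -a

/-- The derivation `∂_x = Dθ²`. -/
def dx (a : R) : R := Dθ (Dθ a)

/-- The logarithmic derivative `Dθ ln Φ` of an invertible bosonic superfield. -/
def dLog (Φ : Rˣ) : R := ↑Φ⁻¹ * Dθ (Φ : R)

/-- The constrained super-Lax operator `L = 𝒟 + f₀ + Φ₀ 𝒟⁻¹ Ψ₀`. -/
noncomputable def lax (f₀ Φ₀ Ψ₀ : R) : SPDO R := ↑(𝒟 : (SPDO R)ˣ) + C f₀ + C Φ₀ * ↑(𝒟 : (SPDO R)ˣ)⁻¹ * C Ψ₀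

/-- The anticommutator. -/
noncomputable def acomm (A B : SPDO R) : SPDO R := A * B + B * A

/-- The functions `L^k(Φ₀)` and `(L^k)^*(Ψ₀)` for `L = 𝒟 + f₀ + Φ₀ 𝒟⁻¹ Ψ₀`.  As `Dθ⁻¹` is only
defined up to a constant of integration, applying `L` to a superfield depends on the choice of the
antiderivatives, which is recorded here:
* `phi k = L^k(Φ₀)` and `psi k = (L^k)^*(Ψ₀)`, of parity `k`;
* `S i j = Dθ⁻¹ ((L^i)^*(Ψ₀) · L^j(Φ₀))` (squared eigenfunction potentials);
* `L(F) = Dθ F + f₀ F + Φ₀ Dθ⁻¹(Ψ₀ F)`, and, by the rules `(AB)^* = (-1)^{|A||B|} B^* A^*`,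
  `𝒟^* = -𝒟`, one has `L^*(G) = -Dθ G + f₀ G + Ψ₀ Dθ⁻¹(Φ₀ G)` and
  `(L^{k+1})^* = (-1)^k L^* (L^k)^*`;
* the constants of integration are consistent with the rule `Dθ⁻¹ Dθ = 1`: by the other fields both
  sides of `by_parts` have the same image `psi i * phi (j+1) - psi (i+1) * phi j` under `Dθ`
  (Leibniz rule), so `by_parts` only normalises the constants; when every superfield has an
  antiderivative, the `S 0 j` can be chosen freely and determine all other fields. -/
structure Potentials (f₀ Φ₀ Ψ₀ : R) where
  phi : ℕ → R
  psi : ℕ → R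
  S : ℕ → ℕ → R
  phi_zero : phi 0 = Φ₀
  psi_zero : psi 0 = Ψ₀
  Dθ_S : ∀ i j, Dθ (S i j) = psi i * phi j
  par_S : ∀ i j, par (S i j) = (-1) ^ (i + j + 1) * S i j
  phi_succ : ∀ k, phi (k + 1) = Dθ (phi k) + f₀ * phi k + Φ₀ * S 0 k
  psi_succ : ∀ k, psi (k + 1) = (-1) ^ k * (-Dθ (psi k) + f₀ * psi k + Ψ₀ * S k 0)
  by_parts : ∀ i j, S i (j + 1) - S (i + 1) j = (-1) ^ i * (psi i * phi j) + S i 0 * S 0 j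

namespace Potentials

variable {f₀ Φ₀ Ψ₀ : R} (P : Potentials f₀ Φ₀ Ψ₀)

/-- `X^{(2n-1)} = 2 ∑_{l=0}^{n-2} L^{2(n-l)-3}(Φ₀) 𝒟⁻¹ (L^{2l+1})^*(Ψ₀)`. -/
noncomputable def X (n : ℕ) : SPDO R :=
  2 * ∑ l ∈ Finset.range (n - 1),
    C (P.phi (2 * (n - l) - 3)) * ↑(𝒟 : (SPDO R)ˣ)⁻¹ * C (P.psi (2 * l + 1))

/-- `X^{(2n-1)}(Φ₀) = 2 ∑_{l=0}^{n-2} L^{2(n-l)-3}(Φ₀) Dθ⁻¹((L^{2l+1})^*(Ψ₀) Φ₀)`. -/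
noncomputable def XPhi (n : ℕ) : R :=
  2 * ∑ l ∈ Finset.range (n - 1), P.phi (2 * (n - l) - 3) * P.S (2 * l + 1) 0

/-- The modified fermionic flow equation
`D_n Φ₀ = L^{2n-1}₊(Φ₀) - 2 L^{2n-1}(Φ₀) + X^{(2n-1)}(Φ₀)` for a derivation `δ = D_n`. -/
def PhiFlow (n : ℕ) (δ : R →+ R) : Prop :=
  δ Φ₀ = (lax f₀ Φ₀ Ψ₀ ^ (2 * n - 1)).apply Φ₀ - 2 * P.phi (2 * n - 1) + P.XPhi n

/-- The modified fermionic Lax equation `D_n L = -{L^{2n-1}₋ - X^{(2n-1)}, L}` for a derivation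
`δ = D_n`, which acts on operators through their coefficients. -/
def LaxFlow (n : ℕ) (δ : R →+ R) : Prop :=
  (lax f₀ Φ₀ Ψ₀).mapCoeff δ
    = -acomm ((lax f₀ Φ₀ Ψ₀ ^ (2 * n - 1)).minus - P.X n) (lax f₀ Φ₀ Ψ₀)

end Potentials

/-- A fermionic flow: an odd derivation that anticommutes with `Dθ`. -/
structure IsFermionicFlow (δ : R →+ R) : Prop where
  map_mul : ∀ a b, δ (a * b) = δ a * b + par a * δ b
  par_map : ∀ a, par (δ a) = -δ (par a)
  anticomm : ∀ a, δ (Dθ a) = -Dθ (δ a)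

/-- The Darboux–Bäcklund operator `T = Φ₀ 𝒟 Φ₀⁻¹`. -/
noncomputable def darboux (Φ₀ : Rˣ) : (SPDO R)ˣ :=
  Units.map (C : R →+* SPDO R).toMonoidHom Φ₀ * 𝒟
    * (Units.map (C : R →+* SPDO R).toMonoidHom Φ₀)⁻¹

/-- The transformed coefficient `f̃₀ = -f₀ - 2 Dθ ln Φ₀`. -/
def dbF (f₀ : R) (Φ₀ : Rˣ) : R := -f₀ - 2 * dLog Φ₀

/-- The transformed coefficient `Φ̃₀ = Φ₀ ∂_x ln Φ₀ + Φ₀ Dθ(f₀) + Φ₀² Ψ₀`. -/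
def dbPhi (f₀ : R) (Φ₀ : Rˣ) (Ψ₀ : R) : R :=
  Φ₀ * (↑Φ₀⁻¹ * dx (Φ₀ : R)) + Φ₀ * Dθ f₀ + (Φ₀ : R) ^ 2 * Ψ₀

end SuperKP

namespace SuperKP

open DiffSuperalgebra

/-! ### Parity calculus and the logarithmic derivative -/

section Superalgebra

variable {R : Type*} [Ring R] [Algebra ℚ R] [DiffSuperalgebra R]

/-! Conjugation by T = Φ₀ 𝒟 Φ₀⁻¹ is done in stages (`darboux_conj_lax`). With g = Dθ ln Φ₀ + f₀, the
gauge by Φ₀ turns L into 𝒟 + g + 𝒟⁻¹Ψ₀Φ₀. Conjugation by 𝒟 then gives 𝒟 - g + (Dθ g + Ψ₀Φ₀)𝒟⁻¹, and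
undoing the gauge restores the constrained form. The new potentials come from integrating S i 0 ·
Dθ(Φ₀⁻¹φ) by parts; their constants are inherited from the old `by_parts`.

For the flow identity put m = 2n-1. The key formula is (L^m)₋ = ∑ φ_{m-1-i} 𝒟⁻¹ ψ_i
(`lax_pow_minus_and_apply`), applied to the transformed operator. Both terms on the left have the
shape T(a)𝒟⁻¹Φ₀⁻¹: a = D_nΦ₀ in D_nT T⁻¹, and a = (L^m)₊(Φ₀) in the negative part of T(L^m)₊T⁻¹. So
by the flow equation the left side has a = -2φ_m + X(Φ₀). On the right, the i = 0 term of -2(L̃^m)₋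
supplies -2φ_m, and its odd terms cancel X̃. Each summand of TXT⁻¹ yields its share of X(Φ₀) plus a
term that cancels an even i ≥ 2 (`darboux_conj_phi_mul_𝒟_inv_mul_psi`).

The Lax flow follows from the graded Leibniz rule: D_nL̃ = {W, L̃} - T(D_nL)T⁻¹ with W = D_nT T⁻¹,
where the flow identity evaluates W. -/

theorem IsOdd.mul_self {a : R} (ha : IsOdd a) : a * a = 0 := by
  have h : a * a + a * a = 0 := by
    nth_rewrite 1 [odd_anticomm a a ha ha]
    exact neg_add_cancel _
  have h2 : (2 : ℚ) • (a * a) = 0 := by rw [two_smul, h]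
  simpa using h2

theorem IsEven.Dθ {a : R} (ha : IsEven a) : IsOdd (Dθ a) := by
  unfold IsOdd IsEven at *
  rw [par_Dθ, ha]

theorem IsOdd.Dθ {a : R} (ha : IsOdd a) : IsEven (Dθ a) := by
  unfold IsOdd IsEven at *
  rw [par_Dθ, ha, map_neg, neg_neg]

theorem IsEven.add {a b : R} (ha : IsEven a) (hb : IsEven b) : IsEven (a + b) := by
  unfold IsEven at *
  rw [map_add, ha, hb]

theorem IsOdd.add {a b : R} (ha : IsOdd a) (hb : IsOdd b) : IsOdd (a + b) := by
  unfold IsOdd at *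
  rw [map_add, ha, hb, neg_add]

theorem IsEven.mul {a b : R} (ha : IsEven a) (hb : IsEven b) : IsEven (a * b) := by
  unfold IsEven at *
  rw [map_mul, ha, hb]

theorem IsEven.mul_odd {a b : R} (ha : IsEven a) (hb : IsOdd b) : IsOdd (a * b) := by
  unfold IsOdd IsEven at *
  rw [map_mul, ha, hb, mul_neg]

theorem IsEven.inv {Φ : Rˣ} (h : IsEven (Φ : R)) : IsEven (↑Φ⁻¹ : R) := by
  unfold IsEven at *
  have h1 : (Φ : R) * par (↑Φ⁻¹ : R) = 1 := by
    nth_rewrite 1 [← h]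
    rw [← map_mul, Units.mul_inv, map_one]
  exact (Units.inv_eq_of_mul_eq_one_right h1).symm

theorem IsEven.commute {a : R} (ha : IsEven a) (b : R) : Commute a b := even_comm a b ha

/-- Moving a fermionic superfield past a superfield of parity `k`. -/
theorem IsOdd.mul_comm_of_par {a b : R} (ha : IsOdd a) {k : ℕ} (hb : par b = (-1) ^ k * b) :
    b * a = (-1) ^ k * (a * b) := by
  rcases Nat.even_or_odd k with hk | hk
  · rw [hk.neg_one_pow, one_mul] at *
    exact even_comm b a hb
  · rw [hk.neg_one_pow, neg_one_mul] at *
    exact odd_anticomm b a hb ha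

theorem Dθ_inv {Φ : Rˣ} (h : IsEven (Φ : R)) :
    Dθ (↑Φ⁻¹ : R) = -(↑Φ⁻¹ * dLog Φ) := by
  have h1 := Dθ_mul (↑Φ⁻¹ : R) (Φ : R)
  rw [Units.inv_mul, SPDO.Dθ_one, h.inv] at h1
  have h2 := congrArg (· * (↑Φ⁻¹ : R)) h1
  simp only [zero_mul, add_mul, mul_assoc, Units.mul_inv, mul_one] at h2
  rw [dLog, (h.inv.commute (DiffSuperalgebra.Dθ (Φ : R))).eq, eq_neg_iff_add_eq_zero]
  exact h2.symm

theorem isOdd_dLog {Φ : Rˣ} (h : IsEven (Φ : R)) : IsOdd (dLog Φ) := h.inv.mul_odd h.Dθ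

/-- Dθ Φ is odd, hence of square zero, so the quadratic term usual for the derivative of a
logarithmic derivative is absent. -/
theorem Dθ_dLog {Φ : Rˣ} (h : IsEven (Φ : R)) : Dθ (dLog Φ) = ↑Φ⁻¹ * dx (Φ : R) := by
  have h0 : dLog Φ * DiffSuperalgebra.Dθ (Φ : R) = 0 := by
    unfold dLog
    rw [mul_assoc, h.Dθ.mul_self, mul_zero]
  conv_lhs => rw [dLog]
  rw [Dθ_mul, Dθ_inv h, h.inv, neg_mul, mul_assoc, h0, mul_zero, neg_zero, zero_add, dx]

theorem mul_dLog (Φ : Rˣ) : (Φ : R) * dLog Φ = Dθ (Φ : R) := by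
  rw [dLog, Units.mul_inv_cancel_left]

end Superalgebra

/-! ### Differential and integral parts, and the action on superfields -/

namespace SPDO

variable {R : Type*} [Ring R]

@[simp] theorem coeff_neg (A : SPDO R) (n : ℤ) : (-A).coeff n = -A.coeff n := rfl

@[simp] theorem coeff_sub (A B : SPDO R) (n : ℤ) : (A - B).coeff n = A.coeff n - B.coeff n := rfl

theorem orderLE_single (k : ℤ) (a : R) : (single k a).OrderLE k := by
  intro n hn
  simp [hn.ne']

/-- A purely differential operator. -/
def IsDiff (A : SPDO R) : Prop := ∀ n, n < 0 → A.coeff n = 0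

theorem IsDiff.add {A B : SPDO R} (hA : A.IsDiff) (hB : B.IsDiff) : (A + B).IsDiff :=
  fun n hn => by simp [hA n hn, hB n hn]

theorem isDiff_single {k : ℤ} (hk : 0 ≤ k) (a : R) : (single k a).IsDiff := by
  intro n hn
  rw [coeff_single, if_neg (by omega)]

theorem isDiff_plus (A : SPDO R) : A.plus.IsDiff := fun n hn => if_neg (by omega)

theorem orderLE_minus (A : SPDO R) : A.minus.OrderLE (-1) := fun n hn => if_neg (by omega)

theorem plus_add_minus (A : SPDO R) : A.plus + A.minus = A := by
  ext n
  change (if 0 ≤ n then A.coeff n else 0) + (if n < 0 then A.coeff n else 0) = _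
  split_ifs <;> first | omega | simp

/-- Uniqueness of the splitting: this and its companion for `minus` read off both parts from any
decomposition of the right orders. -/
theorem plus_eq_of_eq_add {A B N : SPDO R} (h : A = B + N) (hB : B.IsDiff) (hN : N.OrderLE (-1)) :
    A.plus = B := by
  ext n
  change (if 0 ≤ n then A.coeff n else 0) = _
  split_ifs with hn
  · rw [h, coeff_add, hN n (by omega), add_zero]
  · rw [hB n (by omega)]

theorem minus_eq_of_eq_add {A B N : SPDO R} (h : A = B + N) (hB : B.IsDiff)
    (hN : N.OrderLE (-1)) : A.minus = N := by
  ext n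
  change (if n < 0 then A.coeff n else 0) = _
  split_ifs with hn
  · rw [h, coeff_add, hB n (by omega), zero_add]
  · rw [hN n (by omega)]

@[simp] theorem coeff_mapCoeff (δ : R →+ R) (A : SPDO R) (n : ℤ) :
    (mapCoeff δ A).coeff n = δ (A.coeff n) := rfl

theorem orderLE_mapCoeff {A : SPDO R} {N : ℤ} (hA : A.OrderLE N) (δ : R →+ R) :
    (mapCoeff δ A).OrderLE N :=
  fun n hn => by simp [hA n hn]

variable [Algebra ℚ R] [DiffSuperalgebra R]

theorem coeff_C_mul (a : R) (A : SPDO R) (n : ℤ) : (C a * A).coeff n = a * A.coeff n :=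
  coeff_single_mul 0 a A n

theorem coeff_mul_single_one (A : SPDO R) (k n : ℤ) : (A * single k 1).coeff n = A.coeff (n - k) := by
  rw [coeff_mul, finsum_eq_single _ (n - k)]
  · rw [dPow_single]; simp
  · intro j hj
    rw [dPow_single, coeff_single, if_neg (by omega), mul_zero]

theorem coeff_mul_𝒟 (A : SPDO R) (n : ℤ) :
    (A * ((𝒟 : (SPDO R)ˣ) : SPDO R)).coeff n = A.coeff (n - 1) := coeff_mul_single_one A 1 n

theorem coeff_mul_𝒟_inv (A : SPDO R) (n : ℤ) :
    (A * ((𝒟⁻¹ : (SPDO R)ˣ) : SPDO R)).coeff n = A.coeff (n + 1) := by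
  have := coeff_mul_single_one A (-1) n
  rwa [sub_neg_eq_add] at this

theorem isDiff_C (a : R) : (C a : SPDO R).IsDiff := isDiff_single le_rfl a

theorem isDiff_𝒟 : ((𝒟 : (SPDO R)ˣ) : SPDO R).IsDiff := isDiff_single zero_le_one 1

theorem orderLE_C (a : R) : (C a : SPDO R).OrderLE 0 := orderLE_single 0 a

theorem orderLE_𝒟 : ((𝒟 : (SPDO R)ˣ) : SPDO R).OrderLE 1 := orderLE_single 1 1

theorem orderLE_𝒟_inv : ((𝒟⁻¹ : (SPDO R)ˣ) : SPDO R).OrderLE (-1) := orderLE_single (-1) 1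

theorem orderLE_C_mul_𝒟_inv_mul_C (a b : R) :
    (C a * ((𝒟⁻¹ : (SPDO R)ˣ) : SPDO R) * C b).OrderLE (-1) := by
  simpa using ((orderLE_C a).mul orderLE_𝒟_inv).mul (orderLE_C b)

theorem isDiff_dPow {A : SPDO R} (hA : A.IsDiff) (k : ℕ) : (dPow (k : ℤ) A).IsDiff := by
  induction k with
  | zero => simpa using hA
  | succ k ih =>
    intro n hn
    push_cast
    rw [dPow_succ, coeff_dMulHom, ih n hn, ih (n - 1) (by omega), map_zero, map_zero, add_zero]

theorem IsDiff.mul {A B : SPDO R} (hA : A.IsDiff) (hB : B.IsDiff) : (A * B).IsDiff := by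
  intro n hn
  rw [coeff_mul]
  refine finsum_eq_zero_of_forall_eq_zero fun k => ?_
  rcases lt_or_ge k 0 with hk | hk
  · rw [hA k hk, zero_mul]
  · lift k to ℕ using hk
    rw [isDiff_dPow hB k n hn, mul_zero]

theorem coeff_zero_dPow_C (k : ℕ) (F : R) : (dPow (k : ℤ) (C F)).coeff 0 = Dθ^[k] F := by
  induction k with
  | zero => simp [C]
  | succ k ih =>
    push_cast
    rw [dPow_succ, coeff_dMulHom, ih, isDiff_dPow (isDiff_C F) k (0 - 1) (by omega), map_zero,
      add_zero, Function.iterate_succ_apply']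

/-- The action on a superfield is the zero-order coefficient of the product with it. -/
theorem apply_eq_coeff_mul_C (A : SPDO R) (F : R) : A.apply F = (A * C F).coeff 0 := by
  rw [coeff_mul, apply]
  -- The product sums over ℤ, the action over ℕ: for k < 0 the operator 𝒟^k F has order at most k,
  -- hence no zero-order coefficient.
  have hs : Function.support (fun k : ℤ => A.coeff k * (dPow k (C F)).coeff 0)
      ⊆ Set.range ((↑) : ℕ → ℤ) := by
    intro k hk
    by_contra h
    have hk0 : k < 0 := by
      by_contra hk0
      exact h ⟨k.toNat, by omega⟩
    exact hk (by
      change A.coeff k * (dPow k (C F)).coeff 0 = 0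
      rw [orderLE_dPow (orderLE_C F) k 0 (by omega), mul_zero])
  have h := finsum_mem_range (f := fun k : ℤ => A.coeff k * (dPow k (C F)).coeff 0)
    (Nat.cast_injective (R := ℤ))
  rw [← finsum_mem_inter_support, Set.inter_eq_right.2 hs, finsum_mem_support] at h
  rw [h]
  exact finsum_congr fun k => by rw [coeff_zero_dPow_C]

/-- Right division by 𝒟: once the zero-order coefficient is removed, multiplying by 𝒟⁻¹ creates no
negative powers. -/
theorem IsDiff.exists_eq_C_add_mul_𝒟 {A : SPDO R} (hA : A.IsDiff) :
    ∃ Q : SPDO R, Q.IsDiff ∧ A = C (A.coeff 0) + Q * ↑(𝒟 : (SPDO R)ˣ) := by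
  refine ⟨(A - C (A.coeff 0)) * ↑(𝒟⁻¹ : (SPDO R)ˣ), ?_, by
    rw [Units.inv_mul_cancel_right]; abel⟩
  intro n hn
  rw [coeff_mul_𝒟_inv, coeff_sub]
  rcases eq_or_ne (n + 1) 0 with h | h
  · rw [h]
    simp [C]
  · rw [hA (n + 1) (by omega), isDiff_C _ (n + 1) (by omega), sub_zero]

/-- Since Q𝒟𝒟⁻¹ = Q is differential, the negative part of A F 𝒟⁻¹ is exactly A(F)𝒟⁻¹. This isolates
every integral part below. -/
theorem IsDiff.exists_mul_C {A : SPDO R} (hA : A.IsDiff) (F : R) :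
    ∃ Q : SPDO R, Q.IsDiff ∧ A * C F = C (A.apply F) + Q * ↑(𝒟 : (SPDO R)ˣ) := by
  rw [apply_eq_coeff_mul_C]
  exact (hA.mul (isDiff_C F)).exists_eq_C_add_mul_𝒟

theorem apply_add_left (A B : SPDO R) (F : R) : (A + B).apply F = A.apply F + B.apply F := by
  simp only [apply_eq_coeff_mul_C, add_mul, coeff_add]

theorem apply_add (A : SPDO R) (F G : R) : A.apply (F + G) = A.apply F + A.apply G := by
  simp only [apply_eq_coeff_mul_C, map_add, mul_add, coeff_add]

theorem apply_C (a F : R) : (C a : SPDO R).apply F = a * F := by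
  rw [apply_eq_coeff_mul_C, coeff_C_mul]
  simp [C]

theorem apply_𝒟 (F : R) : ((𝒟 : (SPDO R)ˣ) : SPDO R).apply F = Dθ F := by
  rw [apply_eq_coeff_mul_C, 𝒟_mul_C, coeff_add, coeff_mul_𝒟]
  simp [C]

/-- With B F = B(F) + Q𝒟, the term A Q 𝒟 has no zero-order coefficient. -/
theorem IsDiff.mul_apply {A B : SPDO R} (hA : A.IsDiff) (hB : B.IsDiff) (F : R) :
    (A * B).apply F = A.apply (B.apply F) := by
  obtain ⟨Q, hQ, h⟩ := hB.exists_mul_C F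
  rw [apply_eq_coeff_mul_C, mul_assoc, h, mul_add, coeff_add, ← apply_eq_coeff_mul_C, ← mul_assoc,
    coeff_mul_𝒟, hA.mul hQ _ (by omega), add_zero]

theorem plus_apply (A : SPDO R) (F : R) : A.plus.apply F = A.apply F :=
  finsum_congr fun j => by
    change (if (0 : ℤ) ≤ j then A.coeff j else 0) * _ = _
    rw [if_pos (by omega)]

/-- Integration by parts for `𝒟⁻¹`. -/
theorem 𝒟_inv_mul_C_Dθ_mul_𝒟_inv (s : R) :
    ((𝒟⁻¹ : (SPDO R)ˣ) : SPDO R) * C (Dθ s) * ↑(𝒟⁻¹ : (SPDO R)ˣ)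
      = C s * ↑(𝒟⁻¹ : (SPDO R)ˣ) - ↑(𝒟⁻¹ : (SPDO R)ˣ) * C (par s) := by
  have h : (C (Dθ s) : SPDO R) = ↑(𝒟 : (SPDO R)ˣ) * C s - C (par s) * ↑(𝒟 : (SPDO R)ˣ) := by
    rw [𝒟_mul_C]; abel
  rw [h, mul_sub, sub_mul, Units.inv_mul_cancel_left, ← mul_assoc, Units.mul_inv_cancel_right]

theorem 𝒟_inv_mul_C_mul_𝒟 (s : R) :
    ((𝒟⁻¹ : (SPDO R)ˣ) : SPDO R) * C s * ↑(𝒟 : (SPDO R)ˣ)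
      = C (par s) - ↑(𝒟⁻¹ : (SPDO R)ˣ) * C (Dθ (par s)) := by
  -- Taken at par s, so that the coefficient in front of 𝒟 becomes s itself.
  have h := 𝒟_mul_C (par s)
  rw [par_par] at h
  rw [mul_assoc, ← sub_eq_iff_eq_add'.2 h, mul_sub, Units.inv_mul_cancel_left]

/-! ### Parity of operators and the graded Leibniz rule for flows -/

/-- The parity automorphism of the algebra of operators. -/
def parity (A : SPDO R) : SPDO R :=
  mk (fun n => n.negOnePow • par (A.coeff n)) (by
    obtain ⟨N, hN⟩ := A.exists_orderLE
    exact ⟨N, fun n hn => by simp [hN n hn]⟩)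

@[simp] theorem coeff_parity (A : SPDO R) (n : ℤ) :
    (parity A).coeff n = n.negOnePow • par (A.coeff n) := rfl

theorem coeff_smul (u : ℤˣ) (A : SPDO R) (n : ℤ) : (u • A).coeff n = u • A.coeff n := by
  rcases Int.units_eq_one_or u with rfl | rfl <;> simp

theorem units_smul_map {M N : Type*} [AddCommGroup M] [AddCommGroup N] (f : M →+ N) (u : ℤˣ)
    (x : M) : f (u • x) = u • f x := by
  rcases Int.units_eq_one_or u with rfl | rfl <;> simp

/-- Serves both `parity` and the coefficientwise action of D_n. Negative powers are reached because
left multiplication by 𝒟 is injective. -/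
theorem map_dPow_of_anticomm {E : SPDO R → SPDO R}
    (hE : ∀ A, E (dMulHom A) = -dMulHom (E A)) (k : ℤ) (A : SPDO R) :
    E (dPow k A) = k.negOnePow • dPow k (E A) := by
  refine zpow_ind (p := fun k => E (dPow k A) = k.negOnePow • dPow k (E A)) (by simp) ?_ k
  intro k
  rw [dPow_succ, dPow_succ, hE, Int.negOnePow_succ, Units.neg_smul,
    ← units_smul_map (dMulHom (R := R)), neg_inj]
  exact (dMulHom_injective (R := R)).eq_iff.symm

theorem parity_dMulHom (A : SPDO R) : parity (dMulHom A) = -dMulHom (parity A) := by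
  ext n
  have h := units_smul_map (par : R →+* R).toAddMonoidHom (n - 1).negOnePow
    (par (A.coeff (n - 1)))
  simp only [RingHom.toAddMonoidHom_eq_coe, AddMonoidHom.coe_coe] at h
  rw [coeff_parity, coeff_neg, coeff_dMulHom, coeff_dMulHom, coeff_parity, coeff_parity,
    units_smul_map, h, Int.negOnePow_sub, Int.negOnePow_one, map_add, par_Dθ]
  simp [smul_add, add_comm]

theorem coeff_mul_of_le {A B : SPDO R} {N M L : ℤ} (hA : A.OrderLE N) (hB : B.OrderLE M) (n : ℤ)
    (hL : N ≤ L) :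
    (A * B).coeff n = ∑ k ∈ Finset.Icc (n - M) L, A.coeff k * (dPow k B).coeff n :=
  coeff_mul_eq_sum hA hB le_rfl hL

theorem orderLE_parity {A : SPDO R} {N : ℤ} (hA : A.OrderLE N) : (parity A).OrderLE N :=
  fun n hn => by simp [hA n hn]

theorem parity_mul (A B : SPDO R) : parity (A * B) = parity A * parity B := by
  obtain ⟨N, hN⟩ := A.exists_orderLE
  obtain ⟨M, hM⟩ := B.exists_orderLE
  ext n
  rw [coeff_parity, coeff_mul_of_le hN hM n le_rfl,
    coeff_mul_of_le (orderLE_parity hN) (orderLE_parity hM) n le_rfl, map_sum, Finset.smul_sum]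
  refine Finset.sum_congr rfl fun k _ => ?_
  have h := congrArg (fun X : SPDO R => X.coeff n) (map_dPow_of_anticomm parity_dMulHom k B)
  simp only [coeff_parity, coeff_smul] at h
  rw [map_mul, ← mul_smul_comm, h, coeff_parity, mul_smul_comm, smul_mul_assoc]

/-- Moving D_n past a_k 𝒟^k costs par on a_k and (-1)^k on 𝒟^k; together these signs are `parity`.
-/
theorem mapCoeff_mul {δ : R →+ R} (hδ : IsFermionicFlow δ) (A B : SPDO R) :
    mapCoeff δ (A * B) = mapCoeff δ A * B + parity A * mapCoeff δ B := by
  obtain ⟨N, hN⟩ := A.exists_orderLE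
  obtain ⟨M, hM⟩ := B.exists_orderLE
  have hd : ∀ X : SPDO R, mapCoeff δ (dMulHom X) = -dMulHom (mapCoeff δ X) := by
    intro X
    ext n
    simp only [coeff_mapCoeff, coeff_dMulHom, coeff_neg, map_add, hδ.anticomm, hδ.par_map]
    abel
  ext n
  rw [coeff_add, coeff_mapCoeff, coeff_mul_of_le hN hM n le_rfl,
    coeff_mul_of_le (orderLE_mapCoeff hN δ) hM n le_rfl,
    coeff_mul_of_le (orderLE_parity hN) (orderLE_mapCoeff hM δ) n le_rfl, map_sum,
    ← Finset.sum_add_distrib]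
  refine Finset.sum_congr rfl fun k _ => ?_
  have h := congrArg (fun X : SPDO R => X.coeff n) (map_dPow_of_anticomm hd k B)
  simp only [coeff_mapCoeff, coeff_smul] at h
  rw [hδ.map_mul, h, coeff_mapCoeff, coeff_parity, mul_smul_comm, smul_mul_assoc]

theorem parity_add (A B : SPDO R) : parity (A + B) = parity A + parity B := by
  ext n
  simp [smul_add]

theorem parity_single (k : ℤ) (a : R) : parity (single k a) = k.negOnePow • single k (par a) := by
  ext n
  rw [coeff_parity, coeff_smul, coeff_single, coeff_single]
  split_ifs with h
  · rw [h]
  · simp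

theorem parity_C (a : R) : parity (C a) = C (par a) := by
  change parity (single 0 a) = _
  rw [parity_single, Int.negOnePow_zero, one_smul]
  rfl

theorem parity_𝒟 : parity ((𝒟 : (SPDO R)ˣ) : SPDO R) = -↑(𝒟 : (SPDO R)ˣ) := by
  change parity (single 1 1) = _
  rw [parity_single, Int.negOnePow_one, map_one, Units.neg_smul, one_smul]
  rfl

theorem parity_𝒟_inv : parity ((𝒟⁻¹ : (SPDO R)ˣ) : SPDO R) = -↑(𝒟⁻¹ : (SPDO R)ˣ) := by
  change parity (single (-1) 1) = _
  rw [parity_single, Int.negOnePow_neg, Int.negOnePow_one, map_one, Units.neg_smul, one_smul]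
  rfl

end SPDO

open SPDO

variable {R : Type*} [Ring R] [Algebra ℚ R] [DiffSuperalgebra R]

theorem Dθ_neg_one_pow_mul (k : ℕ) (a : R) : Dθ ((-1) ^ k * a) = (-1) ^ k * Dθ a := by
  rcases neg_one_pow_eq_or R k with h | h <;> simp [h]

/-! ### Integral parts of the powers of the Lax operator -/

namespace Potentials

variable {f₀ Φ₀ Ψ₀ : R} (P : Potentials f₀ Φ₀ Ψ₀)

theorem par_phi (hf : IsOdd f₀) (hΦ : IsEven Φ₀) (k : ℕ) : par (P.phi k) = (-1) ^ k * P.phi k := by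
  induction k with
  | zero => simpa [P.phi_zero, IsEven] using hΦ
  | succ k ih =>
    unfold IsOdd IsEven at *
    rw [P.phi_succ, map_add, map_add, map_mul, map_mul, par_Dθ, ih, hf, hΦ, P.par_S,
      Dθ_neg_one_pow_mul, zero_add, pow_succ]
    rcases neg_one_pow_eq_or R k with h | h <;> simp [h, add_comm]

theorem par_psi (hf : IsOdd f₀) (hΨ : IsEven Ψ₀) (k : ℕ) : par (P.psi k) = (-1) ^ k * P.psi k := by
  induction k with
  | zero => simpa [P.psi_zero, IsEven] using hΨ
  | succ k ih =>
    unfold IsOdd IsEven at *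
    rw [P.psi_succ, map_mul, map_add, map_add, map_mul, map_mul, map_neg, par_Dθ, ih, hf, hΨ,
      P.par_S, Dθ_neg_one_pow_mul, add_zero, pow_succ]
    rcases neg_one_pow_eq_or R k with h | h <;> simp [h, add_comm]

/-- Since ψ_i Φ₀ = Dθ S_{i0}, the product with the integral part of L can be integrated by parts.
What then collects behind 𝒟⁻¹ is the recursion for ψ_{i+1}. -/
theorem phi_mul_𝒟_inv_mul_psi_mul_lax (hf : IsOdd f₀) (hΨ : IsEven Ψ₀) (i j : ℕ) :
    C (P.phi j) * ↑(𝒟⁻¹ : (SPDO R)ˣ) * C (P.psi i) * lax f₀ Φ₀ Ψ₀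
      = C (P.phi j * ((-1) ^ i * P.psi i)) +
        (C (P.phi j) * ↑(𝒟⁻¹ : (SPDO R)ˣ) * C (P.psi (i + 1))
          + C (P.phi j * P.S i 0) * ↑(𝒟⁻¹ : (SPDO R)ˣ) * C Ψ₀) := by
  have h1 := 𝒟_inv_mul_C_mul_𝒟 (P.psi i)
  have h2 : ((𝒟⁻¹ : (SPDO R)ˣ) : SPDO R) * C (P.psi i) * C Φ₀ * ↑(𝒟⁻¹ : (SPDO R)ˣ) * C Ψ₀
      = C (P.S i 0) * ↑(𝒟⁻¹ : (SPDO R)ˣ) * C Ψ₀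
        - ↑(𝒟⁻¹ : (SPDO R)ˣ) * C (par (P.S i 0) * Ψ₀) := by
    have h0 : C (P.psi i) * C Φ₀ = C (Dθ (P.S i 0)) := by
      rw [P.Dθ_S, P.phi_zero, map_mul]
    rw [mul_assoc (_ : SPDO R) (C (P.psi i)), h0,
      𝒟_inv_mul_C_Dθ_mul_𝒟_inv, sub_mul, map_mul, mul_assoc (_ : SPDO R) (C (par (P.S i 0)))]
  -- The sign (-1)^i of the recursion is absorbed by the parities of ψ_i and S_{i0}.
  have h3 : P.psi (i + 1) = -Dθ (par (P.psi i)) + P.psi i * f₀ - par (P.S i 0) * Ψ₀ := by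
    rw [P.psi_succ, P.par_psi hf hΨ, P.par_S, hf.mul_comm_of_par (P.par_psi hf hΨ i), add_zero,
      pow_succ, mul_assoc _ (P.S i 0), ← (hΨ.commute (P.S i 0)).eq, Dθ_neg_one_pow_mul]
    rcases neg_one_pow_eq_or R i with h | h <;> simp [h, add_comm, sub_eq_add_neg]
  have h4 : C (P.phi j) * ↑(𝒟⁻¹ : (SPDO R)ˣ) * C (P.psi i) * lax f₀ Φ₀ Ψ₀
      = C (P.phi j) * (↑(𝒟⁻¹ : (SPDO R)ˣ) * C (P.psi i) * ↑(𝒟 : (SPDO R)ˣ))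
        + C (P.phi j) * (↑(𝒟⁻¹ : (SPDO R)ˣ) * (C (P.psi i) * C f₀))
        + C (P.phi j) *
          (↑(𝒟⁻¹ : (SPDO R)ˣ) * C (P.psi i) * C Φ₀ * ↑(𝒟⁻¹ : (SPDO R)ˣ) * C Ψ₀) := by
    rw [lax]
    simp only [mul_add, mul_assoc]
  rw [h4, h1, h2, h3, P.par_psi hf hΨ i]
  simp only [map_add, map_sub, map_neg, map_mul C, mul_add, mul_sub, mul_neg, mul_assoc]
  abel

/-- Write A Φ₀ = A(Φ₀) + Q𝒟. Then A Φ₀𝒟⁻¹Ψ₀ splits off QΨ₀, and applying the same identity to S_{0s}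
gives A(Φ₀S_{0s}) = A(Φ₀)S_{0s} + Q(Ψ₀φ_s). -/
theorem exists_isDiff_mul_lax {A : SPDO R} (hA : A.IsDiff) :
    ∃ B : SPDO R, B.IsDiff ∧
      A * lax f₀ Φ₀ Ψ₀ = B + C (A.apply Φ₀) * ↑(𝒟⁻¹ : (SPDO R)ˣ) * C Ψ₀ ∧
      ∀ s, B.apply (P.phi s) = A.apply (P.phi (s + 1)) - A.apply Φ₀ * P.S 0 s := by
  obtain ⟨Q, hQ, h⟩ := hA.exists_mul_C Φ₀
  have hL : (↑(𝒟 : (SPDO R)ˣ) + C f₀ : SPDO R).IsDiff := isDiff_𝒟.add (isDiff_C f₀)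
  have hB : (A * (↑(𝒟 : (SPDO R)ˣ) + C f₀) + Q * C Ψ₀ : SPDO R).IsDiff :=
    IsDiff.add (hA.mul hL) (hQ.mul (isDiff_C Ψ₀))
  refine ⟨_, hB, ?_, fun s => ?_⟩
  · rw [lax, mul_add, ← mul_assoc, ← mul_assoc, h, add_mul, Units.mul_inv_cancel_right, add_mul]
    abel
  · have h1 : A.apply (Φ₀ * P.S 0 s) = A.apply Φ₀ * P.S 0 s + Q.apply (Ψ₀ * P.phi s) := by
      rw [← apply_C Φ₀, ← hA.mul_apply (isDiff_C Φ₀), h, apply_add_left, apply_C,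
        hQ.mul_apply isDiff_𝒟, apply_𝒟, P.Dθ_S, P.psi_zero]
    rw [apply_add_left, hA.mul_apply hL, hQ.mul_apply (isDiff_C Ψ₀), apply_add_left, apply_𝒟,
      apply_C, apply_C, P.phi_succ, apply_add A (_ + _), h1]
    abel

/-- The two claims need a joint induction: in L^{k+1} the factor in front of 𝒟⁻¹Ψ₀ is (L^k)₊(Φ₀) + ∑
φ_{k-1-i}S_{i0}, and the second claim at s = 0 identifies it with φ_k. The second claim expresses
L^k₊(φ_s) = L^k(φ_s) - L^k₋(φ_s) with the chosen antiderivatives. -/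
theorem lax_pow_minus_and_apply (hf : IsOdd f₀) (hΨ : IsEven Ψ₀) (k : ℕ) :
    (lax f₀ Φ₀ Ψ₀ ^ k).minus
        = ∑ i ∈ Finset.range k, C (P.phi (k - 1 - i)) * ↑(𝒟⁻¹ : (SPDO R)ˣ) * C (P.psi i) ∧
      ∀ s, (lax f₀ Φ₀ Ψ₀ ^ k).plus.apply (P.phi s)
        = P.phi (k + s) - ∑ i ∈ Finset.range k, P.phi (k - 1 - i) * P.S i s := by
  induction k with
  | zero =>
    have h1 : (1 : SPDO R).IsDiff := by rw [← map_one C]; exact isDiff_C 1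
    have h0 : (0 : SPDO R).OrderLE (-1) := fun _ _ => rfl
    rw [pow_zero]
    refine ⟨minus_eq_of_eq_add (add_zero 1).symm h1 h0, fun s => ?_⟩
    rw [plus_eq_of_eq_add (add_zero 1).symm h1 h0, ← map_one C, apply_C]
    simp
  | succ k ih =>
    obtain ⟨ih1, ih2⟩ := ih
    obtain ⟨B, hB, hBL, hBs⟩ := P.exists_isDiff_mul_lax (isDiff_plus (lax f₀ Φ₀ Ψ₀ ^ k))
    set q := (lax f₀ Φ₀ Ψ₀ ^ k).plus.apply Φ₀ with hq
    have hqk : q = P.phi k - ∑ i ∈ Finset.range k, P.phi (k - 1 - i) * P.S i 0 := by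
      have := ih2 0
      rwa [P.phi_zero] at this
    have key : lax f₀ Φ₀ Ψ₀ ^ (k + 1)
        = (B + C (∑ i ∈ Finset.range k, P.phi (k - 1 - i) * ((-1) ^ i * P.psi i)))
          + ∑ i ∈ Finset.range (k + 1),
            C (P.phi (k + 1 - 1 - i)) * ↑(𝒟⁻¹ : (SPDO R)ˣ) * C (P.psi i) := by
      rw [Finset.sum_range_succ', P.psi_zero, pow_succ]
      conv_lhs => rw [← plus_add_minus (lax f₀ Φ₀ Ψ₀ ^ k)]
      rw [add_mul, hBL, ih1, Finset.sum_mul, hqk]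
      rw [Finset.sum_congr rfl fun i _ =>
        P.phi_mul_𝒟_inv_mul_psi_mul_lax hf hΨ i (k - 1 - i)]
      rw [Finset.sum_add_distrib, Finset.sum_add_distrib, map_sub, map_sum, map_sum, sub_mul,
        sub_mul, Finset.sum_mul, Finset.sum_mul]
      have e : ∀ i, k - 1 - i = k - (i + 1) := fun i => by omega
      simp only [e, Nat.add_sub_cancel, Nat.sub_zero]
      abel
    have hd : (B + C (∑ i ∈ Finset.range k, P.phi (k - 1 - i) * ((-1) ^ i * P.psi i))).IsDiff :=
      hB.add (isDiff_C _)
    have ho : (∑ i ∈ Finset.range (k + 1),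
        C (P.phi (k + 1 - 1 - i)) * ↑(𝒟⁻¹ : (SPDO R)ˣ) * C (P.psi i)).OrderLE (-1) :=
      Finset.sum_induction _ (fun A : SPDO R => A.OrderLE (-1)) (fun _ _ => OrderLE.add)
        (fun _ _ => rfl) fun i _ => orderLE_C_mul_𝒟_inv_mul_C _ _
    refine ⟨minus_eq_of_eq_add key hd ho, fun s => ?_⟩
    rw [plus_eq_of_eq_add key hd ho, apply_add_left, apply_C, hBs, ih2, hqk,
      Finset.sum_range_succ', Finset.sum_mul]
    have e : ∀ i, k - 1 - i = k - (i + 1) := fun i => by omega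
    simp only [e, Nat.add_sub_cancel, Nat.sub_zero]
    -- `by_parts` trades S_{i+1,s} for S_{i,s+1}, the form in which the induction hypothesis at s +
    -- 1 is stated; the corrections cancel the new zero-order terms.
    have h3 : ∀ i, P.phi (k - (i + 1)) * P.S (i + 1) s
        = P.phi (k - (i + 1)) * P.S i (s + 1)
          - P.phi (k - (i + 1)) * ((-1) ^ i * P.psi i) * P.phi s
          - P.phi (k - (i + 1)) * P.S i 0 * P.S 0 s := by
      intro i
      rw [← sub_eq_iff_eq_add'.2 (sub_eq_iff_eq_add.1 (P.by_parts i s)).symm.symm]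
      simp only [mul_add, mul_sub, mul_assoc]
      abel
    simp only [h3, Finset.sum_sub_distrib, sub_mul, Finset.sum_mul]
    rw [show k + (s + 1) = k + 1 + s by omega]
    abel

end Potentials

/-! ### The Darboux–Bäcklund operator and the conjugated Lax operator -/

theorem coe_darboux (Φ : Rˣ) :
    (darboux Φ : SPDO R) = C (Φ : R) * ↑(𝒟 : (SPDO R)ˣ) * C (↑Φ⁻¹ : R) := rfl

theorem coe_darboux_inv (Φ : Rˣ) :
    (↑(darboux Φ)⁻¹ : SPDO R) = C (Φ : R) * ↑(𝒟⁻¹ : (SPDO R)ˣ) * C (↑Φ⁻¹ : R) := by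
  rw [darboux, mul_inv_rev, inv_inv, mul_inv_rev, ← mul_assoc]
  rfl

theorem C_mul_C_inv (Φ : Rˣ) : (C (Φ : R) * C (↑Φ⁻¹ : R) : SPDO R) = 1 := by
  rw [← map_mul, Units.mul_inv, map_one]

theorem C_inv_mul_C (Φ : Rˣ) : (C (↑Φ⁻¹ : R) * C (Φ : R) : SPDO R) = 1 := by
  rw [← map_mul, Units.inv_mul, map_one]

theorem darboux_apply (Φ : Rˣ) (F : R) :
    (darboux Φ : SPDO R).apply F = Φ * Dθ (↑Φ⁻¹ * F) := by
  rw [coe_darboux, ((isDiff_C _).mul isDiff_𝒟).mul_apply (isDiff_C _),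
    (isDiff_C _).mul_apply isDiff_𝒟, apply_C, apply_𝒟, apply_C]

theorem dbPhi_eq {f₀ : R} {Φ : Rˣ} {Ψ₀ : R} (hΦ : IsEven (Φ : R)) :
    dbPhi f₀ Φ Ψ₀ = Φ * (Dθ (dLog Φ + f₀) + Ψ₀ * Φ) := by
  rw [dbPhi, map_add, Dθ_dLog hΦ, mul_add, mul_add, sq, mul_assoc (Φ : R) Φ, (hΦ.commute Ψ₀).eq]

theorem dbF_eq (f₀ : R) (Φ : Rˣ) : dbF f₀ Φ = -(dLog Φ + f₀) - dLog Φ := by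
  rw [dbF, two_mul]
  abel

theorem darboux_eq_sub {Φ : Rˣ} (hΦ : IsEven (Φ : R)) :
    (darboux Φ : SPDO R) = ↑(𝒟 : (SPDO R)ˣ) - C (dLog Φ) := by
  rw [coe_darboux, mul_assoc, 𝒟_mul_C, Dθ_inv hΦ, hΦ.inv, mul_add, ← mul_assoc, C_mul_C_inv,
    one_mul, ← map_mul, mul_neg, Units.mul_inv_cancel_left, map_neg]
  abel

theorem C_inv_mul_𝒟_mul_C {Φ : Rˣ} (hΦ : IsEven (Φ : R)) :
    (C (↑Φ⁻¹ : R) * ↑(𝒟 : (SPDO R)ˣ) * C (Φ : R) : SPDO R) = ↑(𝒟 : (SPDO R)ˣ) + C (dLog Φ) := by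
  rw [mul_assoc, 𝒟_mul_C, hΦ, mul_add, ← mul_assoc, C_inv_mul_C, one_mul, ← map_mul, dLog]
  abel

/-- In the gauge by Φ the integral part is 𝒟⁻¹(Ψ₀Φ), and conjugation by 𝒟 moves 𝒟⁻¹ to the right of
its coefficient. As g is odd, 𝒟g = Dθ g - g𝒟, which is why the sign of f₀ flips. -/
theorem darboux_conj_lax {f₀ : R} {Φ : Rˣ} {Ψ₀ : R} (hf : IsOdd f₀) (hΦ : IsEven (Φ : R)) :
    (darboux Φ : SPDO R) * lax f₀ Φ Ψ₀ * ↑(darboux Φ)⁻¹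
      = lax (dbF f₀ Φ) (dbPhi f₀ Φ Ψ₀) (↑Φ⁻¹ : R) := by
  have hg : IsOdd (dLog Φ + f₀) := (isOdd_dLog hΦ).add hf
  set g := dLog Φ + f₀ with hgdef
  have h1 : (C (↑Φ⁻¹ : R) * lax f₀ Φ Ψ₀ * C (Φ : R) : SPDO R)
      = ↑(𝒟 : (SPDO R)ˣ) + C g + ↑(𝒟⁻¹ : (SPDO R)ˣ) * C (Ψ₀ * Φ) := by
    rw [lax, mul_add, mul_add, add_mul, add_mul, C_inv_mul_𝒟_mul_C hΦ, ← map_mul, ← map_mul,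
      mul_assoc (↑Φ⁻¹ : R), ← (hΦ.commute f₀).eq, Units.inv_mul_cancel_left, hgdef, map_add,
      map_mul, mul_assoc (C (Φ : R)), ← mul_assoc (C (↑Φ⁻¹ : R)), C_inv_mul_C, one_mul, mul_assoc]
    abel
  have h2 : (↑(𝒟 : (SPDO R)ˣ) * (↑(𝒟 : (SPDO R)ˣ) + C g + ↑(𝒟⁻¹ : (SPDO R)ˣ) * C (Ψ₀ * Φ))
      * ↑(𝒟⁻¹ : (SPDO R)ˣ) : SPDO R)
      = ↑(𝒟 : (SPDO R)ˣ) - C g + C (Dθ g + Ψ₀ * Φ) * ↑(𝒟⁻¹ : (SPDO R)ˣ) := by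
    rw [mul_add, mul_add, 𝒟_mul_C, hg, Units.mul_inv_cancel_left, add_mul, add_mul, add_mul,
      Units.mul_inv_cancel_right, Units.mul_inv_cancel_right, map_neg, map_add C (Dθ g), add_mul (C (Dθ g))]
    abel
  have h3 : (darboux Φ : SPDO R) * lax f₀ Φ Ψ₀ * ↑(darboux Φ)⁻¹
      = C (Φ : R) * (↑(𝒟 : (SPDO R)ˣ) * (C (↑Φ⁻¹ : R) * lax f₀ Φ Ψ₀ * C (Φ : R))
        * ↑(𝒟⁻¹ : (SPDO R)ˣ)) * C (↑Φ⁻¹ : R) := by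
    rw [coe_darboux, coe_darboux_inv]
    simp only [mul_assoc]
  rw [h3, h1, h2, mul_add, mul_sub, add_mul, sub_mul, ← coe_darboux, darboux_eq_sub hΦ,
    ← map_mul, ← map_mul, (hΦ.commute g).eq, Units.mul_inv_cancel_right, lax, dbPhi_eq hΦ,
    dbF_eq, map_mul C (Φ : R) (_ + _), map_sub, map_neg, mul_assoc (C (Φ : R))]
  simp only [mul_assoc]
  abel

/-! ### Eigenfunctions and potentials of the transformed operator -/

namespace Potentials

variable {f₀ : R} {Φ : Rˣ} {Ψ₀ : R} (P : Potentials f₀ (Φ : R) Ψ₀)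

/-- The eigenfunction recursion in the gauge by Φ, where it starts from the constant 1. -/
theorem inv_mul_phi_succ (hΦ : IsEven (Φ : R)) (k : ℕ) :
    ↑Φ⁻¹ * P.phi (k + 1) = Dθ (↑Φ⁻¹ * P.phi k) + (dLog Φ + f₀) * (↑Φ⁻¹ * P.phi k) + P.S 0 k := by
  rw [P.phi_succ, Dθ_mul, Dθ_inv hΦ, hΦ.inv, mul_add, mul_add, Units.inv_mul_cancel_left, add_mul,
    ← mul_assoc f₀, ← (hΦ.inv.commute f₀).eq, ← mul_assoc (dLog Φ),
    ← (hΦ.inv.commute (dLog Φ)).eq]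
  simp only [neg_mul, mul_assoc]
  abel

theorem inv_mul_phi_one (hΦ : IsEven (Φ : R)) :
    ↑Φ⁻¹ * P.phi 1 = dLog Φ + f₀ + P.S 0 0 := by
  rw [P.inv_mul_phi_succ hΦ 0, P.phi_zero, Units.inv_mul, Dθ_one, mul_one, zero_add]

theorem dbPhi_eq_darboux_apply (hΦ : IsEven (Φ : R)) :
    dbPhi f₀ Φ Ψ₀ = (darboux Φ : SPDO R).apply (P.phi 1) := by
  rw [darboux_apply, P.inv_mul_phi_one hΦ, map_add _ (_ + _), P.Dθ_S, P.phi_zero, P.psi_zero,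
    dbPhi_eq hΦ]

/-- The adjoint eigenfunctions of the transformed operator. -/
def darbouxPsi : ℕ → R
  | 0 => ↑Φ⁻¹
  | s + 1 => (-1) ^ s * (↑Φ⁻¹ * P.S s 0)

/-- The squared eigenfunction potentials of the transformed operator. -/
def darbouxS : ℕ → ℕ → R
  | 0, j => ↑Φ⁻¹ * P.phi (j + 1)
  | i + 1, j => P.S i (j + 1) - P.S i 0 * (↑Φ⁻¹ * P.phi (j + 1))

theorem par_inv_mul_phi (hf : IsOdd f₀) (hΦ : IsEven (Φ : R)) (k : ℕ) :
    par (↑Φ⁻¹ * P.phi k) = (-1) ^ k * (↑Φ⁻¹ * P.phi k) := by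
  rw [map_mul, hΦ.inv, P.par_phi hf hΦ]
  rcases neg_one_pow_eq_or R k with h | h <;> simp [h]

theorem Dθ_S_zero_mul (i : ℕ) (a : R) :
    Dθ (P.S i 0 * a) = P.psi i * (Φ * a) - (-1) ^ i * (P.S i 0 * Dθ a) := by
  rw [Dθ_mul, P.Dθ_S, P.phi_zero, P.par_S, add_zero, pow_succ]
  rcases neg_one_pow_eq_or R i with h | h <;> simp [h, mul_assoc, sub_eq_add_neg]

/-- For i = 0 the factor Φ⁻¹Φ cancels. For i + 1 the integrand is (-1)^i S_{i0} Dθ v with v =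
Φ⁻¹φ_{j+1}, and integration by parts leaves ψ_i φ_{j+1}, whose primitive is S_{i,j+1}. -/
theorem Dθ_darbouxS (hΦ : IsEven (Φ : R)) (i j : ℕ) :
    Dθ (P.darbouxS i j) = P.darbouxPsi i * (Φ * Dθ (↑Φ⁻¹ * P.phi (j + 1))) := by
  cases i with
  | zero => rw [darbouxS, darbouxPsi, Units.inv_mul_cancel_left]
  | succ i =>
    rw [darbouxS, darbouxPsi, map_sub, P.Dθ_S, P.Dθ_S_zero_mul, Units.mul_inv_cancel_left,
      sub_sub_cancel, (hΦ.inv.commute (P.S i 0)).eq, mul_assoc, mul_assoc, Units.inv_mul_cancel_left]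

theorem par_darbouxS (hf : IsOdd f₀) (hΦ : IsEven (Φ : R)) (i j : ℕ) :
    par (P.darbouxS i j) = (-1) ^ (i + j + 1) * P.darbouxS i j := by
  cases i with
  | zero => rw [darbouxS, P.par_inv_mul_phi hf hΦ, zero_add]
  | succ i =>
    rw [darbouxS, map_sub, map_mul par (P.S i 0), P.par_inv_mul_phi hf hΦ, P.par_S, P.par_S]
    simp only [pow_add]
    rcases neg_one_pow_eq_or R i with h | h <;> rcases neg_one_pow_eq_or R j with h' | h' <;>
      simp [h, h', sub_eq_add_neg, add_comm]

/-- For k = 0 the value comes from `inv_mul_phi_one`; beyond that, the recursion is the old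
`by_parts` with second index 0. -/
theorem darbouxPsi_succ (hf : IsOdd f₀) (hΦ : IsEven (Φ : R)) (k : ℕ) :
    P.darbouxPsi (k + 1)
      = (-1) ^ k * (-Dθ (P.darbouxPsi k) + dbF f₀ Φ * P.darbouxPsi k
        + ↑Φ⁻¹ * P.darbouxS k 0) := by
  have hg : IsOdd (dLog Φ + f₀) := (isOdd_dLog hΦ).add hf
  cases k with
  | zero =>
    rw [darbouxPsi, darbouxPsi, darbouxS, Dθ_inv hΦ, zero_add, P.inv_mul_phi_one hΦ, dbF_eq,
      pow_zero, one_mul, one_mul, (hΦ.inv.commute (-(dLog Φ + f₀) - dLog Φ)).symm.eq]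
    simp only [mul_add, mul_neg, mul_sub]
    abel
  | succ k =>
    have hb : P.S (k + 1) 0 = P.S k 1 - (-1) ^ k * (P.psi k * Φ) - P.S k 0 * P.S 0 0 := by
      have := P.by_parts k 0
      rw [P.phi_zero, sub_eq_iff_eq_add] at this
      rw [this]; abel
    have hc : P.S k 0 * (dLog Φ + f₀) = (-1) ^ (k + 1) * ((dLog Φ + f₀) * P.S k 0) :=
      hg.mul_comm_of_par (by rw [P.par_S, add_zero])
    have hcomm : dbF f₀ Φ * (↑Φ⁻¹ * P.S k 0) = ↑Φ⁻¹ * (dbF f₀ Φ * P.S k 0) :=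
      ((hΦ.inv.commute (dbF f₀ Φ)).left_comm (P.S k 0)).symm
    have e : -Dθ (P.darbouxPsi (k + 1)) + dbF f₀ Φ * P.darbouxPsi (k + 1)
        + ↑Φ⁻¹ * P.darbouxS (k + 1) 0
        = ↑Φ⁻¹ * ((-1) ^ k * (dLog Φ * P.S k 0 - P.psi k * Φ + dbF f₀ Φ * P.S k 0)
          + P.S k 1 - P.S k 0 * (dLog Φ + f₀ + P.S 0 0)) := by
      rw [darbouxPsi, darbouxS, zero_add, P.inv_mul_phi_one hΦ, Dθ_neg_one_pow_mul, Dθ_mul,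
        Dθ_inv hΦ, hΦ.inv, P.Dθ_S, P.phi_zero]
      rcases neg_one_pow_eq_or R k with h | h <;>
        simp [h, mul_add, mul_sub, mul_assoc, hcomm] <;> abel
    rw [e, darbouxPsi, hb, mul_add (P.S k 0), hc, dbF_eq, pow_succ]
    rcases neg_one_pow_eq_or R k with h | h <;>
      simp [h, mul_add, mul_sub, add_mul, sub_mul] <;> abel

/-- For i = 0 this is the gauged eigenfunction recursion; for i + 1 it combines the old `by_parts`
for index i at j + 1 and at 0. -/
theorem darboux_by_parts (hΦ : IsEven (Φ : R)) (i j : ℕ) :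
    P.darbouxS i (j + 1) - P.darbouxS (i + 1) j
      = (-1) ^ i * (P.darbouxPsi i * (Φ * Dθ (↑Φ⁻¹ * P.phi (j + 1))))
        + P.darbouxS i 0 * P.darbouxS 0 j := by
  cases i with
  | zero =>
    simp only [darbouxS, darbouxPsi]
    rw [P.inv_mul_phi_succ hΦ (j + 1), zero_add, P.inv_mul_phi_one hΦ, Units.inv_mul_cancel_left,
      pow_zero, one_mul, add_mul _ (P.S 0 0)]
    abel
  | succ i =>
    have hb : ∀ j, P.S i (j + 1) - P.S (i + 1) j = (-1) ^ i * (P.psi i * P.phi j)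
      + P.S i 0 * P.S 0 j := P.by_parts i
    have hv : ∀ k, P.phi k = Φ * (↑Φ⁻¹ * P.phi k) := fun k => by
      rw [Units.mul_inv_cancel_left]
    have h1 := hb (j + 1)
    have h2 := hb 0
    have hcomm : ↑Φ⁻¹ * P.S i 0 = P.S i 0 * (↑Φ⁻¹ : R) := (hΦ.inv.commute _).eq
    simp only [darbouxS, darbouxPsi]
    rw [P.inv_mul_phi_succ hΦ (j + 1), zero_add, P.inv_mul_phi_one hΦ, hcomm]
    rw [hv (j + 1)] at h1
    rw [P.phi_zero, zero_add] at h2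
    set v := ↑Φ⁻¹ * P.phi (j + 1)
    rw [sub_eq_iff_eq_add] at h1
    rw [sub_eq_iff_eq_add'] at h2
    rw [h1, ← sub_eq_iff_eq_add.2 h2]
    rcases neg_one_pow_eq_or R i with h | h <;>
      simp [h, pow_succ, mul_add, add_mul, sub_mul, mul_assoc] <;> abel

/-- Obtained by applying Φ Dθ to the gauged recursion; Dθ S_{0,k+1} = Ψ₀φ_{k+1} supplies the Φ²Ψ₀
part of `dbPhi`. -/
theorem darboux_phi_succ (hf : IsOdd f₀) (hΦ : IsEven (Φ : R)) (k : ℕ) :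
    (Φ : R) * Dθ (↑Φ⁻¹ * P.phi (k + 1 + 1))
      = Dθ (Φ * Dθ (↑Φ⁻¹ * P.phi (k + 1))) + dbF f₀ Φ * (Φ * Dθ (↑Φ⁻¹ * P.phi (k + 1)))
        + dbPhi f₀ Φ Ψ₀ * P.darbouxS 0 k := by
  have hg : IsOdd (dLog Φ + f₀) := (isOdd_dLog hΦ).add hf
  have hv : P.phi (k + 1) = Φ * (↑Φ⁻¹ * P.phi (k + 1)) := by
    rw [Units.mul_inv_cancel_left]
  rw [P.inv_mul_phi_succ hΦ (k + 1), map_add, map_add, Dθ_mul (_ + _), hg, P.Dθ_S, P.psi_zero,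
    darbouxS, Dθ_mul (Φ : R), hΦ, ← mul_dLog, dbPhi_eq hΦ, dbF_eq,
    ((hΦ.commute (-(dLog Φ + f₀) - dLog Φ)).left_comm _).symm]
  conv_lhs => enter [2, 2, 2]; rw [hv]
  simp only [mul_add, add_mul, sub_mul, mul_sub, neg_mul, mul_neg, mul_assoc]
  abel

/-- The potentials of the Darboux–Bäcklund transformed Lax operator. -/
def darbouxTransform (hf : IsOdd f₀) (hΦ : IsEven (Φ : R)) :
    Potentials (dbF f₀ Φ) (dbPhi f₀ Φ Ψ₀) (↑Φ⁻¹ : R) where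
  phi s := Φ * Dθ (↑Φ⁻¹ * P.phi (s + 1))
  psi := P.darbouxPsi
  S := P.darbouxS
  phi_zero := by rw [P.dbPhi_eq_darboux_apply hΦ, darboux_apply]
  psi_zero := rfl
  Dθ_S := P.Dθ_darbouxS hΦ
  par_S := P.par_darbouxS hf hΦ
  phi_succ := P.darboux_phi_succ hf hΦ
  psi_succ := P.darbouxPsi_succ hf hΦ
  by_parts := P.darboux_by_parts hΦ

end Potentials

/-! ### Parity checks and variation of the Darboux operator along a flow -/

theorem isOdd_dbF {f₀ : R} {Φ : Rˣ} (hf : IsOdd f₀) (hΦ : IsEven (Φ : R)) :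
    IsOdd (dbF f₀ Φ) := by
  have h := isOdd_dLog hΦ
  unfold IsOdd at *
  rw [dbF_eq, map_sub, map_neg, map_add, hf, h]
  abel

theorem isEven_dbPhi {f₀ : R} {Φ : Rˣ} {Ψ₀ : R} (hf : IsOdd f₀) (hΦ : IsEven (Φ : R))
    (hΨ : IsEven Ψ₀) : IsEven (dbPhi f₀ Φ Ψ₀) := by
  rw [dbPhi_eq hΦ]
  exact hΦ.mul (((isOdd_dLog hΦ).add hf).Dθ.add (hΨ.mul hΦ))

theorem Dθ_dbF_add {f₀ : R} {Φ : Rˣ} {Ψ₀ : R} (hΦ : IsEven (Φ : R)) :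
    Dθ (dbF f₀ Φ) + 2 * (dbPhi f₀ Φ Ψ₀ * ↑Φ⁻¹) = Dθ f₀ + 2 * (↑Φ * Ψ₀) := by
  rw [dbPhi_eq hΦ, dbF_eq, (hΦ.commute _).eq, Units.mul_inv_cancel_right, map_sub, map_neg,
    map_add, two_mul, two_mul, (hΦ.commute Ψ₀).eq]
  abel

theorem isDiff_darboux (Φ : Rˣ) : (darboux Φ : SPDO R).IsDiff :=
  IsDiff.mul (IsDiff.mul (isDiff_C _) isDiff_𝒟) (isDiff_C _)

theorem orderLE_darboux (Φ : Rˣ) : (darboux Φ : SPDO R).OrderLE 1 := by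
  have h := ((orderLE_C (Φ : R)).mul orderLE_𝒟).mul (orderLE_C (↑Φ⁻¹ : R))
  rw [coe_darboux]
  exact h

theorem orderLE_darboux_inv (Φ : Rˣ) : (↑(darboux Φ)⁻¹ : SPDO R).OrderLE (-1) := by
  rw [coe_darboux_inv]
  exact orderLE_C_mul_𝒟_inv_mul_C _ _

theorem parity_darboux {Φ : Rˣ} (hΦ : IsEven (Φ : R)) :
    parity (darboux Φ : SPDO R) = -(darboux Φ : SPDO R) := by
  rw [coe_darboux, parity_mul, parity_mul, parity_C, parity_C, parity_𝒟, hΦ, hΦ.inv]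
  simp

theorem parity_lax {f₀ Φ₀ Ψ₀ : R} (hf : IsOdd f₀) (hΦ : IsEven Φ₀) (hΨ : IsEven Ψ₀) :
    parity (lax f₀ Φ₀ Ψ₀) = -lax f₀ Φ₀ Ψ₀ := by
  rw [lax, parity_add, parity_add, parity_mul, parity_mul, parity_C, parity_C, parity_C, parity_𝒟,
    parity_𝒟_inv, hf, hΦ, hΨ, map_neg]
  simp only [mul_neg, neg_mul]
  abel

theorem IsFermionicFlow.map_one {δ : R →+ R} (hδ : IsFermionicFlow δ) : δ 1 = 0 := by
  have h := hδ.map_mul 1 1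
  rw [_root_.map_one par, one_mul, mul_one] at h
  simpa using h

/-- Formally D_n ln Φ = Φ⁻¹D_nΦ, and D_n anticommutes with Dθ. -/
theorem IsFermionicFlow.map_dLog {δ : R →+ R} (hδ : IsFermionicFlow δ) {Φ : Rˣ}
    (hΦ : IsEven (Φ : R)) : δ (dLog Φ) = -Dθ (↑Φ⁻¹ * δ Φ) := by
  have hodd : IsOdd (δ (Φ : R)) := by
    unfold IsOdd
    rw [hδ.par_map, hΦ]
  have hinv : δ (↑Φ⁻¹ : R) = -(↑Φ⁻¹ * (↑Φ⁻¹ * δ Φ)) := by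
    have h1 := hδ.map_mul (↑Φ⁻¹ : R) (Φ : R)
    rw [Units.inv_mul, hδ.map_one, hΦ.inv] at h1
    have h2 := congrArg (· * (↑Φ⁻¹ : R)) h1
    simp only [zero_mul, add_mul, mul_assoc, Units.mul_inv, mul_one] at h2
    rw [(hΦ.inv.commute (δ (Φ : R))).eq, eq_neg_iff_add_eq_zero]
    exact h2.symm
  rw [dLog, hδ.map_mul, hinv, hΦ.inv, hδ.anticomm, Dθ_mul, Dθ_inv hΦ, hΦ.inv, dLog]
  simp only [neg_mul, mul_assoc, mul_neg]
  rw [odd_anticomm _ _ hodd hΦ.Dθ]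
  simp only [mul_neg]
  abel

/-- The operator `T(a) 𝒟⁻¹ Φ⁻¹` for the Darboux–Bäcklund operator `T = Φ 𝒟 Φ⁻¹`. -/
noncomputable def darbouxTail (Φ : Rˣ) : R →+ SPDO R where
  toFun a := C (Φ * Dθ (↑Φ⁻¹ * a)) * ↑(𝒟⁻¹ : (SPDO R)ˣ) * C (↑Φ⁻¹ : R)
  map_zero' := by simp
  map_add' a b := by simp [mul_add, add_mul]

theorem darbouxTail_apply (Φ : Rˣ) (a : R) :
    darbouxTail Φ a = C (Φ * Dθ (↑Φ⁻¹ * a)) * ↑(𝒟⁻¹ : (SPDO R)ˣ) * C (↑Φ⁻¹ : R) := rfl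

/-- Division gives TAΦ = (TA)(Φ) + Q𝒟, and T⁻¹ = Φ𝒟⁻¹Φ⁻¹ makes the second term differential. -/
theorem minus_darboux_conj (Φ : Rˣ) {A : SPDO R} (hA : A.IsDiff) :
    ((darboux Φ : SPDO R) * A * ↑(darboux Φ)⁻¹).minus = darbouxTail Φ (A.apply Φ) := by
  have hTA : ((darboux Φ : SPDO R) * A).IsDiff := (isDiff_darboux Φ).mul hA
  obtain ⟨Q, hQ, h⟩ := hTA.exists_mul_C (Φ : R)
  refine minus_eq_of_eq_add (B := Q * C (↑Φ⁻¹ : R)) ?_ (hQ.mul (isDiff_C _))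
    (orderLE_C_mul_𝒟_inv_mul_C _ _)
  rw [coe_darboux_inv, ← mul_assoc, ← mul_assoc, h, add_mul, add_mul, Units.mul_inv_cancel_right,
    (isDiff_darboux Φ).mul_apply hA, darboux_apply, darbouxTail_apply, add_comm]

/-- As T = 𝒟 - Dθ ln Φ, its variation is a mere multiplication operator. -/
theorem mapCoeff_darboux_mul_inv {δ : R →+ R} (hδ : IsFermionicFlow δ) {Φ : Rˣ}
    (hΦ : IsEven (Φ : R)) :
    (darboux Φ : SPDO R).mapCoeff δ * ↑(darboux Φ)⁻¹ = darbouxTail Φ (δ Φ) := by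
  have h : (darboux Φ : SPDO R).mapCoeff δ = C (Dθ (↑Φ⁻¹ * δ Φ)) := by
    rw [darboux_eq_sub hΦ]
    ext n
    rw [coeff_mapCoeff, coeff_sub, map_sub]
    change δ (if n = 1 then 1 else 0) - δ (if n = 0 then dLog Φ else 0)
      = if n = 0 then Dθ (↑Φ⁻¹ * δ Φ) else 0
    rcases eq_or_ne n 0 with rfl | hn
    · simp [hδ.map_dLog hΦ]
    · rcases eq_or_ne n 1 with rfl | hn'
      · simp [hδ.map_one]
      · simp [hn, hn']
  rw [h, coe_darboux_inv, darbouxTail_apply, ← mul_assoc, ← mul_assoc, ← map_mul,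
    (hΦ.commute (Dθ _)).eq]

/-- T and L are both odd. Hence D_n(T⁻¹) = +T⁻¹ (D_nT) T⁻¹, and the two variations of T form an
anticommutator. -/
theorem mapCoeff_darboux_conj_lax {δ : R →+ R} (hδ : IsFermionicFlow δ) {f₀ : R} {Φ : Rˣ} {Ψ₀ : R}
    (hf : IsOdd f₀) (hΦ : IsEven (Φ : R)) (hΨ : IsEven Ψ₀) :
    ((darboux Φ : SPDO R) * lax f₀ Φ Ψ₀ * ↑(darboux Φ)⁻¹ : SPDO R).mapCoeff δ
      = acomm ((darboux Φ : SPDO R).mapCoeff δ * ↑(darboux Φ)⁻¹ : SPDO R)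
          ((darboux Φ : SPDO R) * lax f₀ Φ Ψ₀ * ↑(darboux Φ)⁻¹ : SPDO R)
        - (darboux Φ : SPDO R) * (lax f₀ Φ Ψ₀).mapCoeff δ * ↑(darboux Φ)⁻¹ := by
  have hT := parity_darboux hΦ
  have hL := parity_lax hf hΦ hΨ
  set T := darboux Φ
  set L := lax f₀ Φ Ψ₀
  have h1 : mapCoeff δ (1 : SPDO R) = 0 := by
    ext n
    rw [coeff_mapCoeff, one_def, coeff_single]
    split_ifs <;> simp [hδ.map_one]
  have h2 : mapCoeff δ (↑T⁻¹ : SPDO R) = ↑T⁻¹ * mapCoeff δ (T : SPDO R) * ↑T⁻¹ := by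
    have h := mapCoeff_mul hδ (T : SPDO R) ↑T⁻¹
    rw [Units.mul_inv, h1, hT, neg_mul, ← sub_eq_add_neg, eq_comm, sub_eq_zero] at h
    rw [mul_assoc, h, Units.inv_mul_cancel_left]
  rw [mapCoeff_mul hδ, mapCoeff_mul hδ, parity_mul, hT, hL, h2,
    acomm]
  simp only [neg_mul, mul_neg, neg_neg, add_mul, mul_assoc, Units.inv_mul_cancel_left]
  abel

/-- Separates i = 0, odd i and positive even i, which cancel against different terms of the flow
identity. -/
theorem sum_range_two_mul_add_one {M : Type*} [AddCommMonoid M] (g : ℕ → M) (N : ℕ) :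
    ∑ i ∈ Finset.range (2 * N + 1), g i
      = g 0 + ∑ l ∈ Finset.range N, (g (2 * l + 1) + g (2 * l + 2)) := by
  induction N with
  | zero => simp
  | succ N ih =>
    rw [show 2 * (N + 1) + 1 = 2 * N + 1 + 1 + 1 by ring, Finset.sum_range_succ,
      Finset.sum_range_succ, ih, Finset.sum_range_succ, add_assoc, add_assoc]

/-! ### Preservation of the modified fermionic flows -/

namespace Potentials

variable {f₀ : R} {Φ : Rˣ} {Ψ₀ : R} (P : Potentials f₀ (Φ : R) Ψ₀)

/-- Again ψ_iΦ = Dθ S_{i0} is integrated by parts. Oddness of a and i makes S_{i0} even, so the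
outer 𝒟 produces exactly the Leibniz expansion of T(a S_{i0}). -/
theorem darboux_conj_phi_mul_𝒟_inv_mul_psi (hΦ : IsEven (Φ : R)) {a : R} (ha : IsOdd a) {i : ℕ}
    (hi : Odd i) :
    (darboux Φ : SPDO R) * (C a * ↑(𝒟⁻¹ : (SPDO R)ˣ) * C (P.psi i)) * ↑(darboux Φ)⁻¹
      = darbouxTail Φ (a * P.S i 0)
        - C (Φ * Dθ (↑Φ⁻¹ * a)) * ↑(𝒟⁻¹ : (SPDO R)ˣ) * C (↑Φ⁻¹ * P.S i 0) := by
  have hS : IsEven (P.S i 0) := by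
    unfold IsEven
    rw [P.par_S, add_zero, (hi.add_odd odd_one).neg_one_pow, one_mul]
  have hb : IsOdd (↑Φ⁻¹ * a) := hΦ.inv.mul_odd ha
  set b := ↑Φ⁻¹ * a with hbdef
  set s := P.S i 0 with hs
  have h1 : (C (P.psi i) * C (Φ : R) : SPDO R) = C (Dθ s) := by
    rw [hs, P.Dθ_S, P.phi_zero, map_mul]
  have h2 := 𝒟_inv_mul_C_Dθ_mul_𝒟_inv s
  rw [hS] at h2
  have h3 : (darboux Φ : SPDO R) * (C a * ↑(𝒟⁻¹ : (SPDO R)ˣ) * C (P.psi i)) * ↑(darboux Φ)⁻¹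
      = C (Φ : R) * ((↑(𝒟 : (SPDO R)ˣ) * C b) * (↑(𝒟⁻¹ : (SPDO R)ˣ) * (C (P.psi i) * C (Φ : R))
        * ↑(𝒟⁻¹ : (SPDO R)ˣ))) * C (↑Φ⁻¹ : R) := by
    rw [coe_darboux, coe_darboux_inv, hbdef, map_mul C (↑Φ⁻¹ : R) a]
    simp only [mul_assoc]
  have h4 : (C b * ↑(𝒟 : (SPDO R)ˣ) * (C s * ↑(𝒟⁻¹ : (SPDO R)ˣ)) : SPDO R)
      = C (b * Dθ s) * ↑(𝒟⁻¹ : (SPDO R)ˣ) + C (b * s) := by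
    rw [mul_assoc, ← mul_assoc (_ : SPDO R) (C s), 𝒟_mul_C, hS, add_mul, Units.mul_inv_cancel_right,
      mul_add, ← mul_assoc, ← map_mul, ← map_mul]
  have h5 : (C b * ↑(𝒟 : (SPDO R)ˣ) * (↑(𝒟⁻¹ : (SPDO R)ˣ) * C s) : SPDO R) = C (b * s) := by
    rw [mul_assoc, Units.mul_inv_cancel_left, ← map_mul]
  rw [h3, h1, h2, 𝒟_mul_C, hb, map_neg, neg_mul, ← sub_eq_add_neg, sub_mul, mul_sub (C b * _), h4,
    h5, darbouxTail_apply, ← mul_assoc (↑Φ⁻¹ : R) a, ← hbdef, Dθ_mul b s, hb,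
    (hΦ.inv.commute s).eq]
  simp only [map_mul, map_add, map_neg, mul_add, mul_sub, add_mul, sub_mul, neg_mul, mul_neg,
    mul_assoc]
  abel

theorem darboux_flow (hf : IsOdd f₀) (hΦ : IsEven (Φ : R)) {n : ℕ} (hn : 1 ≤ n)
    {δ : R →+ R} (hδ : IsFermionicFlow δ) (hP : P.PhiFlow n δ) :
    (darboux Φ : SPDO R).mapCoeff δ * ↑(darboux Φ)⁻¹
        - (↑(darboux Φ) * (lax f₀ Φ Ψ₀ ^ (2 * n - 1)).plus * ↑(darboux Φ)⁻¹).minus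
      = -2 * ((↑(darboux Φ) * lax f₀ Φ Ψ₀ * ↑(darboux Φ)⁻¹) ^ (2 * n - 1)).minus
        + (P.darbouxTransform hf hΦ).X n + ↑(darboux Φ) * P.X n * ↑(darboux Φ)⁻¹ := by
  obtain ⟨N, rfl⟩ : ∃ N, n = N + 1 := ⟨n - 1, by omega⟩
  have hm : 2 * (N + 1) - 1 = 2 * N + 1 := by omega
  rw [PhiFlow] at hP
  rw [mapCoeff_darboux_mul_inv hδ hΦ, minus_darboux_conj Φ (isDiff_plus _), plus_apply, ← map_sub,
    hP, darboux_conj_lax hf hΦ,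
    ((P.darbouxTransform hf hΦ).lax_pow_minus_and_apply (isOdd_dbF hf hΦ) hΦ.inv _).1, hm,
    sum_range_two_mul_add_one, X, X, XPhi, Nat.add_sub_cancel]
  -- The i = 0 term, with φ̃_{2N} = T(φ_{2N+1}) and ψ̃₀ = Φ⁻¹ by construction.
  have h0 : C ((P.darbouxTransform hf hΦ).phi (2 * N + 1 - 1 - 0)) * ↑(𝒟⁻¹ : (SPDO R)ˣ)
      * C ((P.darbouxTransform hf hΦ).psi 0) = darbouxTail Φ (P.phi (2 * N + 1)) := rfl
  have h1 : ∀ l ∈ Finset.range N,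
      (darboux Φ : SPDO R) * (C (P.phi (2 * (N + 1 - l) - 3)) * ↑(𝒟⁻¹ : (SPDO R)ˣ)
        * C (P.psi (2 * l + 1))) * ↑(darboux Φ)⁻¹
      = darbouxTail Φ (P.phi (2 * (N + 1 - l) - 3) * P.S (2 * l + 1) 0)
        + C ((P.darbouxTransform hf hΦ).phi (2 * N + 1 - 1 - (2 * l + 2))) * ↑(𝒟⁻¹ : (SPDO R)ˣ)
          * C ((P.darbouxTransform hf hΦ).psi (2 * l + 2)) := by
    intro l hl
    rw [Finset.mem_range] at hl
    have ho : IsOdd (P.phi (2 * (N + 1 - l) - 3)) := by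
      -- As l < N, the index is at least 1, so the truncated subtractions are exact.
      have : Odd (2 * (N + 1 - l) - 3) := ⟨N - l - 1, by omega⟩
      unfold IsOdd
      rw [P.par_phi hf hΦ, this.neg_one_pow, neg_one_mul]
    have hpsi : (P.darbouxTransform hf hΦ).psi (2 * l + 2) = -(↑Φ⁻¹ * P.S (2 * l + 1) 0) := by
      change (-1) ^ (2 * l + 1) * (↑Φ⁻¹ * P.S (2 * l + 1) 0) = _
      rw [(odd_two_mul_add_one l).neg_one_pow, neg_one_mul]
    have hphi : (P.darbouxTransform hf hΦ).phi (2 * N + 1 - 1 - (2 * l + 2))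
        = Φ * Dθ (↑Φ⁻¹ * P.phi (2 * (N + 1 - l) - 3)) := by
      rw [show 2 * (N + 1 - l) - 3 = 2 * N + 1 - 1 - (2 * l + 2) + 1 by omega]
      rfl
    rw [P.darboux_conj_phi_mul_𝒟_inv_mul_psi hΦ ho (odd_two_mul_add_one l), hpsi, hphi, map_neg,
      mul_neg, sub_eq_add_neg]
  have h2 : ∀ l ∈ Finset.range N,
      C ((P.darbouxTransform hf hΦ).phi (2 * (N + 1 - l) - 3)) * ↑(𝒟⁻¹ : (SPDO R)ˣ)
        * C ((P.darbouxTransform hf hΦ).psi (2 * l + 1))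
      = C ((P.darbouxTransform hf hΦ).phi (2 * N + 1 - 1 - (2 * l + 1))) * ↑(𝒟⁻¹ : (SPDO R)ˣ)
        * C ((P.darbouxTransform hf hΦ).psi (2 * l + 1)) := by
    intro l hl
    rw [Finset.mem_range] at hl
    rw [show 2 * (N + 1 - l) - 3 = 2 * N + 1 - 1 - (2 * l + 1) by omega]
  have h3 : (darboux Φ : SPDO R) * (2 * ∑ l ∈ Finset.range N, C (P.phi (2 * (N + 1 - l) - 3)) *
        ↑(𝒟⁻¹ : (SPDO R)ˣ) * C (P.psi (2 * l + 1))) * ↑(darboux Φ)⁻¹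
      = 2 * ∑ l ∈ Finset.range N, (darboux Φ : SPDO R) * (C (P.phi (2 * (N + 1 - l) - 3)) *
        ↑(𝒟⁻¹ : (SPDO R)ˣ) * C (P.psi (2 * l + 1))) * ↑(darboux Φ)⁻¹ := by
    rw [two_mul, two_mul, mul_add, add_mul, Finset.mul_sum, Finset.sum_mul]
  rw [h0, Finset.sum_congr rfl h2, h3, Finset.sum_congr rfl h1, Finset.sum_add_distrib,
    Finset.sum_add_distrib, ← map_sum]
  simp only [two_mul, neg_mul, map_add, map_sub]
  abel

theorem darboux_laxFlow (hf : IsOdd f₀) (hΦ : IsEven (Φ : R)) (hΨ : IsEven Ψ₀) {n : ℕ}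
    (hn : 1 ≤ n) {δ : R →+ R} (hδ : IsFermionicFlow δ) (hP : P.PhiFlow n δ)
    (hL : P.LaxFlow n δ) : (P.darbouxTransform hf hΦ).LaxFlow n δ := by
  have hW := P.darboux_flow hf hΦ hn hδ hP
  have hL' : ((darboux Φ : SPDO R) * (lax f₀ Φ Ψ₀ ^ (2 * n - 1)).minus * ↑(darboux Φ)⁻¹).OrderLE
      (-1) := by
    simpa using ((orderLE_darboux Φ).mul (orderLE_minus _)).mul (orderLE_darboux_inv Φ)
  rw [LaxFlow] at hL ⊢
  rw [← darboux_conj_lax hf hΦ, mapCoeff_darboux_conj_lax hδ hf hΦ hΨ, hL]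
  set T := darboux Φ
  set L := lax f₀ Φ Ψ₀
  have hpow : ((T : SPDO R) * L * ↑T⁻¹) ^ (2 * n - 1) = T * L ^ (2 * n - 1) * ↑T⁻¹ :=
    Units.conj_pow T L _
  set A := L ^ (2 * n - 1)
  have hA : (T : SPDO R) * A * ↑T⁻¹ = T * A.plus * ↑T⁻¹ + T * A.minus * ↑T⁻¹ := by
    rw [← add_mul, ← mul_add, plus_add_minus]
  -- T and T⁻¹ have orders at most 1 and -1, so conjugation keeps A₋ of negative order.
  have hmin : ((T : SPDO R) * A * ↑T⁻¹).minus
      = ((T : SPDO R) * A.plus * ↑T⁻¹).minus + T * A.minus * ↑T⁻¹ := by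
    refine minus_eq_of_eq_add (B := ((T : SPDO R) * A.plus * ↑T⁻¹).plus) ?_ (isDiff_plus _)
      ((orderLE_minus _).add hL')
    rw [← add_assoc, plus_add_minus, hA]
  rw [hpow] at hW ⊢
  have hconj : (T : SPDO R) * -acomm (A.minus - P.X n) L * ↑T⁻¹
      = -acomm (T * (A.minus - P.X n) * ↑T⁻¹ : SPDO R) (T * L * ↑T⁻¹ : SPDO R) := by
    simp only [acomm, mul_neg, neg_mul, mul_add, add_mul, mul_assoc, Units.inv_mul_cancel_left]
  -- One copy of (TA₊T⁻¹)₋ + TA₋T⁻¹ = (L̃^m)₋ reduces the factor -2 of the flow identity to -1; the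
  -- remaining conjugated term is cancelled by T(D_nL)T⁻¹.
  have hWeq : (T : SPDO R).mapCoeff δ * ↑T⁻¹
      = -((T * A * ↑T⁻¹ : SPDO R).minus - (P.darbouxTransform hf hΦ).X n)
        - T * (A.minus - P.X n) * ↑T⁻¹ := by
    rw [sub_eq_iff_eq_add.1 hW, hmin, neg_mul, two_mul, mul_sub, sub_mul]
    abel
  rw [hconj, hWeq]
  simp only [acomm, sub_mul, mul_sub, neg_mul, mul_neg]
  abel

end Potentials

end SuperKP

open SuperKP SPDO DiffSuperalgebra in
theorem proposition3 {R : Type*} [Ring R] [Algebra ℚ R] [DiffSuperalgebra R]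
    (f₀ : R) (Φ₀ : Rˣ) (Ψ₀ : R)
    (hf : IsOdd f₀) (hΦ : IsEven (Φ₀ : R)) (hΨ : IsEven Ψ₀)
    (P : Potentials f₀ (Φ₀ : R) Ψ₀) :
    -- the constrained form is preserved
    (↑(darboux Φ₀) * lax f₀ Φ₀ Ψ₀ * ↑(darboux Φ₀)⁻¹
        = lax (dbF f₀ Φ₀) (dbPhi f₀ Φ₀ Ψ₀) (↑Φ₀⁻¹ : R)) ∧
    IsOdd (dbF f₀ Φ₀) ∧ IsEven (dbPhi f₀ Φ₀ Ψ₀) ∧ IsEven (↑Φ₀⁻¹ : R) ∧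
    (Dθ (dbF f₀ Φ₀) + 2 * (dbPhi f₀ Φ₀ Ψ₀ * ↑Φ₀⁻¹) = Dθ f₀ + 2 * (↑Φ₀ * Ψ₀)) ∧
    (dbPhi f₀ Φ₀ Ψ₀ = (darboux Φ₀ : SPDO R).apply (P.phi 1)) ∧
    -- the transformed potentials
    ∃ P' : Potentials (dbF f₀ Φ₀) (dbPhi f₀ Φ₀ Ψ₀) (↑Φ₀⁻¹ : R),
      (∀ s, P'.phi s = (darboux Φ₀ : SPDO R).apply (P.phi (s + 1))) ∧
      (∀ s, P'.psi (s + 1) = (-1) ^ s * (↑Φ₀⁻¹ * P.S s 0)) ∧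
      -- the modified fermionic flows
      ∀ n : ℕ, 1 ≤ n → ∀ δ : R →+ R, IsFermionicFlow δ → P.PhiFlow n δ →
        ((darboux Φ₀ : SPDO R).mapCoeff δ * ↑(darboux Φ₀)⁻¹
            - (↑(darboux Φ₀) * (lax f₀ Φ₀ Ψ₀ ^ (2 * n - 1)).plus * ↑(darboux Φ₀)⁻¹).minus
          = -2 * ((↑(darboux Φ₀) * lax f₀ Φ₀ Ψ₀ * ↑(darboux Φ₀)⁻¹) ^ (2 * n - 1)).minus
            + P'.X n + ↑(darboux Φ₀) * P.X n * ↑(darboux Φ₀)⁻¹) ∧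
        (P.LaxFlow n δ → P'.LaxFlow n δ) := by
  refine ⟨darboux_conj_lax hf hΦ, isOdd_dbF hf hΦ, isEven_dbPhi hf hΦ hΨ, hΦ.inv, Dθ_dbF_add hΦ,
    P.dbPhi_eq_darboux_apply hΦ, P.darbouxTransform hf hΦ, fun s => (darboux_apply _ _).symm,
    fun _ => rfl, fun n hn δ hδ hP => ⟨P.darboux_flow hf hΦ hn hδ hP,
      P.darboux_laxFlow hf hΦ hΨ hn hδ hP⟩⟩
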